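/- Let $\mathcal U\subseteq\mathbb R^n$ be an open neighborhood of the origin and let $G=(g_1,\dots,g_k):\mathcal U\to\mathbb R^k$ be a $C^\infty$ map with $G(\mathbf 0)=\mathbf 0$ which is not constant on any neighborhood of $\mathbf 0$. Write $B_\epsilon$, $B^\circ_\epsilon$, $\partial B_\epsilon$ for the closed ball, the open ball and the sphere of radius $\epsilon$ centered at the origin (of $\mathbb R^n$ or of $\mathbb R^k$). Put $X:=G^{-1}(\mathbf 0)$ and $r(x):=|x|^2$, let $\mathfrak A$ be the set of points of $\mathcal U$ at which $\nabla g_1,\dots,\nabla g_k$ are linearly dependent, and let $\mathfrak B$ be the set of points of $\mathcal U$ at which $\nabla r,\nabla g_1,\dots,\nabla g_k$ are linearly dependent. Suppose that $G$ satisfies Milnor's condition (a) at $\mathbf 0$, i.e. $\mathbf 0\notin\overline{\mathfrak A-X}$, and Milnor's condition (b) at $\mathbf 0$, i.e. $\mathbf 0$ is an isolated point of, or is not in, $X\cap\overline{\mathfrak B-X}$. Let $\epsilon_0>0$ be a Milnor radius for $G$ at $\mathbf 0$, i.e. $B_{\epsilon_0}\subseteq\mathcal U$, $B_{\epsilon_0}\cap\overline{\mathfrak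 A-X}=\emptyset$ and $B_{\epsilon_0}\cap X\cap\overline{\mathfrak B-X}\subseteq\{\mathbf 0\}$. Subsets of the closed ball $B_\epsilon$ are stratified by their intersections with $B^\circ_\epsilon$ and with $\partial B_\epsilon$. A stratified submersion is a smooth map from a manifold with boundary to a manifold whose restrictions to the interior and to the boundary are submersions. A locally trivial fibration is a smooth map which, over a neighborhood of each point $y$ of the base, is diffeomorphic over the base to the product of that neighborhood with the fiber over $y$ (over different components of the base the fibers may differ, and they may be empty). 1. For all $\epsilon$ with $0<\epsilon<\epsilon_0$ there exists $\delta_\epsilon>0$ such that $$G:B_\epsilon\cap G^{-1}\big(B^\circ_{\delta_\epsilon}-\{\mathbf 0\}\big)\to B^\circ_{\delta_\epsilon}-\{\mathbf 0\}\qquad(*)$$ is a proper stratified submersion. 2. For every pair $(\epsilon,\delta_\epsilon)$ with $0<\epsilon<\epsilon_0$ and $\delta_\epsilon>0$ for which $(*)$ is a proper stratified submersion, the map $(*)$ is a locally trivial fibration in which the local trivializations preserve the strata. Moreover, for all $\delta$ with $0<\delta<\delta_\epsilon$, the map $$G:B_\epsilon\cap G^{-1}(\partial B_\delta)\to\partial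 B_\delta$$ is a proper stratified submersion and a locally trivial fibration in which the local trivializations preserve the strata, and the map $$G:B^\circ_\epsilon\cap G^{-1}(\partial B_\delta)\to\partial B_\delta$$ is a locally trivial fibration. 3. The diffeomorphism types of these two fibrations over spheres are independent of the choice of such $\epsilon$ and $\delta$: if $(\epsilon,\delta_\epsilon)$ and $(\epsilon',\delta_{\epsilon'})$ are two pairs as in 2, $0<\delta<\delta_\epsilon$ and $0<\delta'<\delta_{\epsilon'}$, then there are a strata-preserving diffeomorphism $B_\epsilon\cap G^{-1}(\partial B_\delta)\to B_{\epsilon'}\cap G^{-1}(\partial B_{\delta'})$ and a diffeomorphism $B^\circ_\epsilon\cap G^{-1}(\partial B_\delta)\to B^\circ_{\epsilon'}\cap G^{-1}(\partial B_{\delta'})$, each covering the rescaling $y\mapsto(\delta'/\delta)\,y$ from $\partial B_\delta$ to $\partial B_{\delta'}$. -/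

import Mathlib

open Set Metric Topology
open scoped ContDiff

namespace MilnorFib

section Smooth

variable {E F : Type*} [NormedAddCommGroup E] [NormedSpace ℝ E]
  [NormedAddCommGroup F] [NormedSpace ℝ F]

/-- A map is smooth on an arbitrary subset `S` of a normed space if near every point of `S` it
agrees on `S` with a `C^∞` map defined on an open neighbourhood of that point. -/
def SmoothOnSet (f : E → F) (S : Set E) : Prop :=
  ∀ x ∈ S, ∃ V : Set E, IsOpen V ∧ x ∈ V ∧
    ∃ f' : E → F, ContDiffOn ℝ ∞ f' V ∧ EqOn f' f (S ∩ V)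

/-- `f` restricts to a diffeomorphism from the subset `S` onto the subset `T`. -/
def IsDiffeoOn (f : E → F) (S : Set E) (T : Set F) : Prop :=
  SmoothOnSet f S ∧ MapsTo f S T ∧
    ∃ g : F → E, SmoothOnSet g T ∧ MapsTo g T S ∧ InvOn g f S T

/-- `γ` is, near time `0`, a smooth curve in `M` which passes through `x` at time `0`. -/
def IsCurveThrough (M : Set E) (x : E) (γ : ℝ → E) : Prop :=
  γ 0 = x ∧ ∃ η > 0, ContDiffOn ℝ ∞ γ (Ioo (-η) η) ∧ ∀ t ∈ Ioo (-η) η, γ t ∈ M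

/-- The tangent vectors to `M` at `x`: velocities of smooth curves in `M` through `x`. -/
def tangentVectors (M : Set E) (x : E) : Set E :=
  {v | ∃ γ : ℝ → E, IsCurveThrough M x γ ∧ HasDerivAt γ v 0}

/-- `M` is a smooth embedded submanifold of codimension `c` with boundary `bM`: near a point
outside `bM` it is the zero set of a map `h` to `ℝ^c` submersive at the point (and `bM` is absent),
near a point of `bM` it is `{h = 0, ρ ≤ 0}` with `bM` given by `{h = 0, ρ = 0}`, where `(h, ρ)` is
submersive at the point. -/
def IsSubmanifoldWithBoundary (M bM : Set E) (c : ℕ) : Prop :=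
  bM ⊆ M ∧
  (∀ x ∈ M \ bM, ∃ V : Set E, IsOpen V ∧ x ∈ V ∧ bM ∩ V = ∅ ∧
    ∃ h : E → (Fin c → ℝ), ContDiffOn ℝ ∞ h V ∧
      Function.Surjective (fderiv ℝ h x) ∧
      M ∩ V = {y ∈ V | h y = 0}) ∧
  (∀ x ∈ bM, ∃ V : Set E, IsOpen V ∧ x ∈ V ∧
    ∃ (h : E → (Fin c → ℝ)) (ρ : E → ℝ), ContDiffOn ℝ ∞ h V ∧ ContDiffOn ℝ ∞ ρ V ∧
      Function.Surjective (fun v : E => (fderiv ℝ h x v, fderiv ℝ ρ x v)) ∧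
      M ∩ V = {y ∈ V | h y = 0 ∧ ρ y ≤ 0} ∧
      bM ∩ V = {y ∈ V | h y = 0 ∧ ρ y = 0})

/-- `G` restricts to a smooth submersion `M → N`: the differential at each `x ∈ M`, which sends the
velocity of a curve `γ` to that of `G ∘ γ`, is onto the tangent space of `N` at `G x`. -/
def IsSubmersionOn (G : E → F) (M : Set E) (N : Set F) : Prop :=
  SmoothOnSet G M ∧ MapsTo G M N ∧
    ∀ x ∈ M, ∀ w ∈ tangentVectors N (G x),
      ∃ γ : ℝ → E, IsCurveThrough M x γ ∧ HasDerivAt (G ∘ γ) w 0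

/-- `G : M → N` is a stratified submersion, where `M` is a manifold with boundary `bM`, stratified
by its interior `M \ bM` and its boundary `bM`, and `N` is a manifold: it is smooth, and its
restriction to each of the two strata is a submersion. -/
def IsStratifiedSubmersion (G : E → F) (M bM : Set E) (N : Set F) : Prop :=
  (∃ c, IsSubmanifoldWithBoundary M bM c) ∧ (∃ c, IsSubmanifoldWithBoundary N ∅ c) ∧
    SmoothOnSet G M ∧ IsSubmersionOn G (M \ bM) N ∧ IsSubmersionOn G bM N

/-- `G` maps `M` into `N`, and `G : M → N` is a proper map of topological spaces. -/
def IsProperOn (G : E → F) (M : Set E) (N : Set F) : Prop :=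
  ∃ h : MapsTo G M N, IsProperMap (h.restrict G M N)

/-- `G : M → N` is proper and a stratified submersion. -/
def IsProperStratifiedSubmersion (G : E → F) (M bM : Set E) (N : Set F) : Prop :=
  IsProperOn G M N ∧ IsStratifiedSubmersion G M bM N

/-- `G : M → N` is a smooth locally trivial fibration whose local trivializations preserve the
strata `M \ bM` and `bM`. Fibres over different components of `N` may differ, and may be empty. -/
def IsLocallyTrivialFibration (G : E → F) (M bM : Set E) (N : Set F) : Prop :=
  SmoothOnSet G M ∧ MapsTo G M N ∧
    ∀ y ∈ N, ∃ V : Set F, IsOpen V ∧ y ∈ V ∧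
      ∃ Φ : E → F × E,
        IsDiffeoOn Φ (M ∩ G ⁻¹' V) ((N ∩ V) ×ˢ (M ∩ G ⁻¹' {y})) ∧
        (∀ x ∈ M ∩ G ⁻¹' V, (Φ x).1 = G x) ∧
        Φ '' ((M \ bM) ∩ G ⁻¹' V) = (N ∩ V) ×ˢ ((M \ bM) ∩ G ⁻¹' {y}) ∧
        Φ '' (bM ∩ G ⁻¹' V) = (N ∩ V) ×ˢ (bM ∩ G ⁻¹' {y})

/-- `(Φ, ψ)` is a diffeomorphism from the fibration `G : M → N` to the fibration `G : M' → N'`,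
preserving the strata. -/
def IsFibrationDiffeo (G : E → F) (M bM : Set E) (N : Set F) (M' bM' : Set E) (N' : Set F)
    (Φ : E → E) (ψ : F → F) : Prop :=
  IsDiffeoOn Φ M M' ∧ Φ '' bM = bM' ∧ IsDiffeoOn ψ N N' ∧ ∀ x ∈ M, G (Φ x) = ψ (G x)

end Smooth

section Milnor

variable {n k : ℕ}

/-- `V(G) = G⁻¹(0)`, for `G` with domain `U`. -/
def zeroLocus (U : Set (EuclideanSpace ℝ (Fin n)))
    (G : EuclideanSpace ℝ (Fin n) → EuclideanSpace ℝ (Fin k)) :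
    Set (EuclideanSpace ℝ (Fin n)) :=
  {x ∈ U | G x = 0}

/-- The critical locus: points of `U` where `∇g₁, …, ∇gₖ` are linearly dependent. -/
def critLocus (U : Set (EuclideanSpace ℝ (Fin n)))
    (G : EuclideanSpace ℝ (Fin n) → EuclideanSpace ℝ (Fin k)) :
    Set (EuclideanSpace ℝ (Fin n)) :=
  {x ∈ U | ¬ LinearIndependent ℝ (fun i : Fin k => gradient (fun y => G y i) x)}

/-- Points of `U` where `∇r, ∇g₁, …, ∇gₖ` are linearly dependent, where `r(x) = |x|²`. -/
def relCritLocus (U : Set (EuclideanSpace ℝ (Fin n)))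
    (G : EuclideanSpace ℝ (Fin n) → EuclideanSpace ℝ (Fin k)) :
    Set (EuclideanSpace ℝ (Fin n)) :=
  {x ∈ U | ¬ LinearIndependent ℝ
    (Fin.cons (gradient (fun y : EuclideanSpace ℝ (Fin n) => ‖y‖ ^ 2) x)
      (fun i : Fin k => gradient (fun y => G y i) x) :
        Fin (k + 1) → EuclideanSpace ℝ (Fin n))}

/-- Milnor's condition (a) at the origin. -/
def MilnorCondA (U : Set (EuclideanSpace ℝ (Fin n)))
    (G : EuclideanSpace ℝ (Fin n) → EuclideanSpace ℝ (Fin k)) : Prop :=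
  (0 : EuclideanSpace ℝ (Fin n)) ∉ closure (critLocus U G \ zeroLocus U G)

/-- Milnor's condition (b) at the origin: `0` is an isolated point of, or is not in,
`X ∩ closure (𝔅 - X)`. -/
def MilnorCondB (U : Set (EuclideanSpace ℝ (Fin n)))
    (G : EuclideanSpace ℝ (Fin n) → EuclideanSpace ℝ (Fin k)) : Prop :=
  ∃ W ∈ 𝓝 (0 : EuclideanSpace ℝ (Fin n)),
    W ∩ (zeroLocus U G ∩ closure (relCritLocus U G \ zeroLocus U G)) ⊆ {0}

/-- `ε` is a Milnor radius, i.e. both a Milnor (a) and a Milnor (b) radius; the closed ball of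
radius `ε` has to lie in the domain `U` of `G`. -/
def IsMilnorRadius (U : Set (EuclideanSpace ℝ (Fin n)))
    (G : EuclideanSpace ℝ (Fin n) → EuclideanSpace ℝ (Fin k)) (ε : ℝ) : Prop :=
  0 < ε ∧ closedBall 0 ε ⊆ U ∧
    closedBall 0 ε ∩ closure (critLocus U G \ zeroLocus U G) = ∅ ∧
    closedBall 0 ε ∩ (zeroLocus U G ∩ closure (relCritLocus U G \ zeroLocus U G)) ⊆ {0}

/-- The map `G : B_ε ∩ G⁻¹(B°_δ - {0}) → B°_δ - {0}` is a proper stratified submersion. -/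
def IsTubePair (G : EuclideanSpace ℝ (Fin n) → EuclideanSpace ℝ (Fin k)) (ε δ : ℝ) : Prop :=
  IsProperStratifiedSubmersion G
    (closedBall 0 ε ∩ G ⁻¹' (ball 0 δ \ {0})) (sphere 0 ε ∩ G ⁻¹' (ball 0 δ \ {0}))
    (ball 0 δ \ {0})

end Milnor

end MilnorFib

/-! By condition (a), `G` is submersive at every point of the Milnor ball outside `X`. By condition
(b), the part of the closure of `𝔅 - X` in the Milnor ball with `|x| ≥ ρ` is a compact set disjoint
from `X`, so `|G|` is bounded below on it by some `δ > 0`: wherever `|x| ≥ ρ` and `0 < |G x| < δ`,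
the sphere through `x` is transverse to the fibre of `G`. With `ρ = ε` this makes (*) a submersion
on both strata; properness is compactness of the ball. Conversely, any pair as in 2 yields the same
surjectivity of differentials (`SubmersiveOver`).

The rest is Ehresmann's theorem for a ball with boundary. A partition of unity gives a compactly
supported field of operators `L x` which lift target vectors through `dG` and are tangent to the
spheres of radius near `ε` (`exists_lift`). Solving `γ' = L γ a` up to time 1 lifts the segment from
`G x` to `G x + a`; the endpoint is `T x a` (`IsTransport`). The map `T · a` preserves the ball and
the sphere, is inverted by `T · (-a)`, and is smooth in `(x, a)`, because the solution is the fixed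
point of a smooth family of contractions of `C([0, 1], E)`. This needs `a` small; iterating with `a
/ N` removes the restriction.

Everything else is a choice of `a`. Taking `a = y - G x` gives local trivializations. Radial `a`
compares two values of `δ` (`exists_rescale`). Transport for `(G, |x|²)`, moving only the second
coordinate, slides points along the fibres of `G` and compares two values of `ε` at a small level
(`exists_change_radius`). Two arbitrary pairs are joined by descending to a common small level,
changing the radius there, and climbing back. -/

namespace MilnorFib

set_option linter.unusedSectionVars false

/-! ### Smoothness of composition operators on spaces of continuous maps -/

section Nemytskii

universe u

variable {α : Type*} [TopologicalSpace α] [CompactSpace α]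

/-- The pointwise application of a continuous family of operators to a continuous family of
vectors, as a bounded bilinear map. -/
noncomputable def pointwiseApply (α : Type*) [TopologicalSpace α] [CompactSpace α]
    (E F : Type*) [NormedAddCommGroup E] [NormedSpace ℝ E]
    [NormedAddCommGroup F] [NormedSpace ℝ F] :
    C(α, E →L[ℝ] F) →L[ℝ] C(α, E) →L[ℝ] C(α, F) :=
  LinearMap.mkContinuous₂
    (LinearMap.mk₂ ℝ
      (fun (A : C(α, E →L[ℝ] F)) (h : C(α, E)) =>
        (⟨fun t => A t (h t), A.continuous.clm_apply h.continuous⟩ : C(α, F)))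
      (fun _ _ _ => by ext; simp) (fun _ _ _ => by ext; simp)
      (fun _ _ _ => by ext; simp) (fun _ _ _ => by ext; simp))
    1 (fun A h => by
      rw [ContinuousMap.norm_le _ (by positivity)]
      intro t
      calc ‖A t (h t)‖ ≤ ‖A t‖ * ‖h t‖ := (A t).le_opNorm _
        _ ≤ 1 * ‖A‖ * ‖h‖ := by
          rw [one_mul]
          gcongr
          · exact A.norm_coe_le_norm t
          · exact h.norm_coe_le_norm t)

@[simp] theorem pointwiseApply_apply {E F : Type*} [NormedAddCommGroup E] [NormedSpace ℝ E]
    [NormedAddCommGroup F] [NormedSpace ℝ F] (A : C(α, E →L[ℝ] F)) (h : C(α, E)) (t : α) :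
    pointwiseApply α E F A h t = A t (h t) := rfl

/-- The range of `γ` is compact, so `f'` is uniformly continuous along it; the mean value inequality
on balls of one common radius then bounds the error uniformly in `t`. -/
theorem hasFDerivAt_postcomp {E F : Type*} [NormedAddCommGroup E] [NormedSpace ℝ E]
    [NormedAddCommGroup F] [NormedSpace ℝ F] (f : C(E, F)) (f' : C(E, E →L[ℝ] F))
    (hf : ∀ x, HasFDerivAt f (f' x) x) (γ : C(α, E)) :
    HasFDerivAt (fun γ : C(α, E) => f.comp γ) (pointwiseApply α E F (f'.comp γ)) γ := by
  rw [hasFDerivAt_iff_isLittleO_nhds_zero, Asymptotics.isLittleO_iff]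
  intro c hc
  have hK : IsCompact (range γ) := isCompact_range γ.continuous
  have h1 := hK.uniformContinuousAt_of_continuousAt f' (fun a _ => f'.continuous.continuousAt)
    (Metric.dist_mem_uniformity hc)
  obtain ⟨δ, hδ, h2⟩ := Metric.mem_uniformity_dist.1 h1
  filter_upwards [Metric.ball_mem_nhds (0 : C(α, E)) hδ] with h hh
  rw [mem_ball_zero_iff] at hh
  rw [ContinuousMap.norm_le _ (by positivity)]
  intro t
  have hht : ‖h t‖ < δ := (h.norm_coe_le_norm t).trans_lt hh
  have key := Convex.norm_image_sub_le_of_norm_hasFDerivWithin_le' (𝕜 := ℝ) (f := f) (f' := f')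
    (C := c) (s := ball (γ t) δ) (x := γ t) (y := γ t + h t) (φ := f' (γ t))
    (fun x _ => (hf x).hasFDerivWithinAt)
    (fun x hx => by
      have := h2 (a := γ t) (b := x) (by rw [dist_comm]; exact hx) (mem_range_self t)
      rw [← dist_eq_norm, dist_comm]
      exact le_of_lt this)
    (convex_ball _ _) (mem_ball_self hδ) (by simpa using hht)
  have e : (f.comp (γ + h) - f.comp γ - pointwiseApply α E F (f'.comp γ) h) t
      = f (γ t + h t) - f (γ t) - f' (γ t) (γ t + h t - γ t) := by simp
  rw [e]
  refine key.trans ?_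
  rw [add_sub_cancel_left]
  gcongr
  exact h.norm_coe_le_norm t

/-- The derivative of composition with `f` is pointwise application of composition with `fderiv ℝ
f`, so induction on `n` has to vary the target: `F` is replaced by `E →L[ℝ] F`, which is why both
spaces share a universe. -/
theorem contDiff_nat_postcomp {E : Type u} [NormedAddCommGroup E] [NormedSpace ℝ E] (n : ℕ) :
    ∀ {F : Type u} [NormedAddCommGroup F] [NormedSpace ℝ F] (f : C(E, F)),
      ContDiff ℝ ∞ f → ContDiff ℝ n (fun γ : C(α, E) => f.comp γ) := by
  induction n with
  | zero =>
    intro F _ _ f _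
    exact contDiff_zero.2 (ContinuousMap.continuous_postcomp f)
  | succ n ih =>
    intro F _ _ f hf
    have hf' : ContDiff ℝ ∞ (fderiv ℝ f) := (contDiff_infty_iff_fderiv.1 hf).2
    have := ih ⟨fderiv ℝ f, hf'.continuous⟩ hf'
    refine contDiff_succ_iff_hasFDerivAt.2 ⟨fun γ => pointwiseApply α E F
      ((⟨fderiv ℝ f, hf'.continuous⟩ : C(E, E →L[ℝ] F)).comp γ),
      ContDiff.comp (g := pointwiseApply α E F) (ContinuousLinearMap.contDiff _) this,
      fun γ => ?_⟩
    exact hasFDerivAt_postcomp f ⟨fderiv ℝ f, hf'.continuous⟩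
      (fun x => ((contDiff_infty_iff_fderiv.1 hf).1 x).hasFDerivAt) γ

/-- Composition with a smooth map is a smooth operation on continuous maps. -/
theorem contDiff_postcomp {E F : Type u} [NormedAddCommGroup E] [NormedSpace ℝ E]
    [NormedAddCommGroup F] [NormedSpace ℝ F] (f : C(E, F)) (hf : ContDiff ℝ ∞ f) :
    ContDiff ℝ ∞ (fun γ : C(α, E) => f.comp γ) :=
  contDiff_infty.2 fun n => contDiff_nat_postcomp n f hf

end Nemytskii

/-! ### Smooth dependence of fixed points on parameters -/

section FixedPoint

variable {P V : Type*} [NormedAddCommGroup P] [NormedSpace ℝ P] [CompleteSpace P]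
  [NormedAddCommGroup V] [NormedSpace ℝ V] [CompleteSpace V]

/-- The fixed point of a family of contractions depends smoothly on the parameter. -/
theorem contDiffAt_fixedPoint {Ψ : P × V → V} (hΨ : ContDiff ℝ ∞ Ψ) {Γ : P → V} {p₀ : P}
    {K : NNReal} (hK : K < 1) (hLip : LipschitzWith K (fun v => Ψ (p₀, v)))
    (hfix : Ψ (p₀, Γ p₀) = Γ p₀)
    (huniq : ∀ᶠ p in 𝓝 p₀, ∀ v, Ψ (p, v) = v → v = Γ p) : ContDiffAt ℝ ∞ Γ p₀ := by
  set f : P × V → V := fun q => q.2 - Ψ q with hf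
  have hfs : ContDiff ℝ ∞ f := contDiff_snd.sub hΨ
  have hd : Differentiable ℝ Ψ := hΨ.differentiable (by simp)
  set D := fderiv ℝ Ψ (p₀, Γ p₀) ∘SL ContinuousLinearMap.inr ℝ P V with hD
  have hDn : ‖D‖ ≤ K := by
    refine HasFDerivAt.le_of_lipschitz (f := fun v => Ψ (p₀, v)) (x₀ := Γ p₀) ?_ hLip
    exact (hd (p₀, Γ p₀)).hasFDerivAt.comp (Γ p₀) (hasFDerivAt_prodMk_right p₀ (Γ p₀))
  -- The partial derivative of `v - Ψ (p, v)` in `v` is `1 - D` with `‖D‖ ≤ K < 1`, invertible by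
  -- the Neumann series. The implicit function then exists, and `huniq` identifies it with `Γ` near
  -- `p₀`.
  have hinv : (fderiv ℝ f (p₀, Γ p₀) ∘SL ContinuousLinearMap.inr ℝ P V).IsInvertible := by
    have e : fderiv ℝ f (p₀, Γ p₀) ∘SL ContinuousLinearMap.inr ℝ P V = 1 - D := by
      have h1 : HasFDerivAt f (ContinuousLinearMap.snd ℝ P V - fderiv ℝ Ψ (p₀, Γ p₀))
          (p₀, Γ p₀) := hasFDerivAt_snd.sub (hd _).hasFDerivAt
      rw [h1.fderiv]
      ext v
      simp [hD]
    obtain ⟨u, hu⟩ := isUnit_one_sub_of_norm_lt_one (x := D) (hDn.trans_lt (by exact_mod_cast hK))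
    rw [e, ← hu]
    exact ⟨ContinuousLinearEquiv.ofUnit u, rfl⟩
  have hat : ContDiffAt ℝ ∞ f (p₀, Γ p₀) := hfs.contDiffAt
  have hs := hat.contDiffAt_implicitFunction (by simp) hinv
  refine hs.congr_of_eventuallyEq ?_
  have h2 := hat.eventually_apply_implicitFunction (by simp) hinv
  filter_upwards [h2, huniq] with p hp hu
  symm
  apply hu
  have h3 : f (p₀, Γ p₀) = 0 := by simp [hf, hfix]
  rw [h3] at hp
  exact (sub_eq_zero.1 hp).symm

end FixedPoint

/-! ### The differential equation of the lift and its smooth dependence on data -/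

section Flow

universe u

variable {E F : Type u} [NormedAddCommGroup E] [NormedSpace ℝ E] [CompleteSpace E]
  [NormedAddCommGroup F] [NormedSpace ℝ F]

/-- The extension of a curve on `[0, 1]` to the real line which is constant on either side. -/
noncomputable def extendCurve (γ : C(unitInterval, E)) : ℝ → E :=
  fun s => γ (projIcc 0 1 zero_le_one s)

theorem continuous_extendCurve (γ : C(unitInterval, E)) : Continuous (extendCurve γ) :=
  γ.continuous.comp continuous_projIcc

theorem extendCurve_coe (γ : C(unitInterval, E)) (t : unitInterval) :
    extendCurve γ t = γ t := by
  simp [extendCurve]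

/-- Integration from `0`, as a bounded operator on curves. -/
noncomputable def primitive (E : Type*) [NormedAddCommGroup E] [NormedSpace ℝ E]
    [CompleteSpace E] : C(unitInterval, E) →L[ℝ] C(unitInterval, E) :=
  LinearMap.mkContinuous
    { toFun := fun γ => ⟨fun t => ∫ s in (0 : ℝ)..t, extendCurve γ s,
        (intervalIntegral.continuous_primitive
          (fun a b => (continuous_extendCurve γ).intervalIntegrable a b) 0).comp
            continuous_subtype_val⟩
      map_add' := fun γ γ' => by
        ext t
        exact intervalIntegral.integral_add
          ((continuous_extendCurve γ).intervalIntegrable _ _)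
          ((continuous_extendCurve γ').intervalIntegrable _ _)
      map_smul' := fun c γ => by
        ext t
        exact intervalIntegral.integral_smul c _ }
    1 (fun γ => by
      rw [ContinuousMap.norm_le _ (by positivity)]
      intro t
      have := intervalIntegral.norm_integral_le_of_norm_le_const (a := 0) (b := (t : ℝ))
        (f := extendCurve γ) (C := ‖γ‖) (fun s _ => γ.norm_coe_le_norm _)
      refine this.trans ?_
      rw [sub_zero, abs_of_nonneg t.2.1, one_mul]
      exact mul_le_of_le_one_right (norm_nonneg _) t.2.2)

theorem norm_primitive_le (γ : C(unitInterval, E)) : ‖primitive E γ‖ ≤ ‖γ‖ := by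
  simpa using LinearMap.mkContinuous_norm_le _ zero_le_one _ |> fun h =>
    (primitive E).le_of_opNorm_le h γ

/-- Constant curves, as a bounded linear map. -/
noncomputable def constCurve (E : Type*) [NormedAddCommGroup E] [NormedSpace ℝ E] :
    E →L[ℝ] C(unitInterval, E) :=
  LinearMap.mkContinuous
    { toFun := fun x => ContinuousMap.const _ x
      map_add' := fun _ _ => rfl
      map_smul' := fun _ _ => rfl } 1 (fun x => by
      rw [ContinuousMap.norm_le _ (by positivity)]
      intro t
      rw [one_mul]
      exact le_rfl)

@[simp] theorem constCurve_apply (x : E) (t : unitInterval) : constCurve E x t = x := rfl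

/-- The Picard operator of the differential equation `γ' = L γ a` with initial value `x`. -/
noncomputable def picardMap (L : C(E, F →L[ℝ] E)) (q : (E × F) × C(unitInterval, E)) :
    C(unitInterval, E) :=
  constCurve E q.1.1 +
    primitive E (pointwiseApply unitInterval F E (L.comp q.2) (constCurve F q.1.2))

theorem picardMap_apply (L : C(E, F →L[ℝ] E)) (x : E) (a : F) (γ : C(unitInterval, E))
    (t : unitInterval) :
    picardMap L ((x, a), γ) t = x + ∫ s in (0 : ℝ)..t, L (extendCurve γ s) a := rfl

theorem contDiff_picardMap (L : C(E, F →L[ℝ] E)) (hL : ContDiff ℝ ∞ L) :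
    ContDiff ℝ ∞ (picardMap L) := by
  have h1 : ContDiff ℝ ∞ (fun q : (E × F) × C(unitInterval, E) => L.comp q.2) :=
    (contDiff_postcomp (α := unitInterval) L hL).comp contDiff_snd
  have h2 : ContDiff ℝ ∞ (fun q : (E × F) × C(unitInterval, E) =>
      pointwiseApply unitInterval F E (L.comp q.2)) :=
    ContDiff.comp (g := pointwiseApply unitInterval F E) (ContinuousLinearMap.contDiff _) h1
  have h3 : ContDiff ℝ ∞ (fun q : (E × F) × C(unitInterval, E) => constCurve F q.1.2) :=
    (constCurve F).contDiff.comp (contDiff_snd.comp contDiff_fst)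
  have h4 : ContDiff ℝ ∞ (fun q : (E × F) × C(unitInterval, E) => constCurve E q.1.1) :=
    (constCurve E).contDiff.comp (contDiff_fst.comp contDiff_fst)
  exact h4.add ((primitive E).contDiff.comp (h2.clm_apply h3))

/-- Integration over `[0, 1]` has norm at most one. The contraction constant is made small through
the parameter `a`, the time interval being fixed. -/
theorem lipschitzWith_picardMap (L : C(E, F →L[ℝ] E)) {K : NNReal} (hK : LipschitzWith K L)
    (p : E × F) : LipschitzWith (K * ‖p.2‖₊) (fun γ => picardMap L (p, γ)) := by
  refine LipschitzWith.of_dist_le_mul fun γ γ' => ?_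
  rw [dist_eq_norm, dist_eq_norm]
  simp only [picardMap, add_sub_add_left_eq_sub, ← map_sub]
  refine (norm_primitive_le _).trans ?_
  rw [ContinuousMap.norm_le _ (by positivity)]
  intro t
  rw [← sub_apply, ← map_sub]
  calc ‖(L (γ t) - L (γ' t)) p.2‖ ≤ ‖L (γ t) - L (γ' t)‖ * ‖p.2‖ :=
        ContinuousLinearMap.le_opNorm _ _
    _ ≤ (K * ‖γ - γ'‖) * ‖p.2‖ := by
        gcongr
        rw [← dist_eq_norm]
        refine (hK.dist_le_mul _ _).trans ?_
        gcongr
        rw [dist_eq_norm]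
        exact (γ - γ').norm_coe_le_norm t
    _ = _ := by push_cast; ring

/-- The solution of `γ' = L γ a` on `[0, 1]` with initial value `x`. -/
noncomputable def solutionCurve (L : C(E, F →L[ℝ] E)) (p : E × F) : C(unitInterval, E) :=
  Classical.epsilon fun γ => picardMap L (p, γ) = γ

/-- For `K * ‖a‖ < 1` the Picard operator is a contraction, so the chosen curve really is a fixed
point; for larger `a` nothing is claimed about it. -/
theorem picardMap_solutionCurve (L : C(E, F →L[ℝ] E)) {K : NNReal} (hK : LipschitzWith K L)
    {p : E × F} (hp : K * ‖p.2‖₊ < 1) :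
    picardMap L (p, solutionCurve L p) = solutionCurve L p := by
  have hc : ContractingWith (K * ‖p.2‖₊) (fun γ => picardMap L (p, γ)) :=
    ⟨hp, lipschitzWith_picardMap L hK p⟩
  exact Classical.epsilon_spec (p := fun γ => picardMap L (p, γ) = γ)
    ⟨_, hc.fixedPoint_isFixedPt⟩

theorem eq_solutionCurve (L : C(E, F →L[ℝ] E)) {K : NNReal} (hK : LipschitzWith K L)
    {p : E × F} (hp : K * ‖p.2‖₊ < 1) {γ : C(unitInterval, E)} (hγ : picardMap L (p, γ) = γ) :
    γ = solutionCurve L p := by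
  have hc : ContractingWith (K * ‖p.2‖₊) (fun γ => picardMap L (p, γ)) :=
    ⟨hp, lipschitzWith_picardMap L hK p⟩
  exact hc.fixedPoint_unique' hγ (picardMap_solutionCurve L hK hp)

theorem contDiffAt_solutionCurve [CompleteSpace F] (L : C(E, F →L[ℝ] E)) (hL : ContDiff ℝ ∞ L)
    {K : NNReal} (hK : LipschitzWith K L) {p : E × F} (hp : K * ‖p.2‖₊ < 1) :
    ContDiffAt ℝ ∞ (solutionCurve L) p := by
  refine contDiffAt_fixedPoint (contDiff_picardMap L hL) hp (lipschitzWith_picardMap L hK p)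
    (picardMap_solutionCurve L hK hp) ?_
  have hcont : Continuous fun q : E × F => K * ‖q.2‖₊ := by fun_prop
  filter_upwards [hcont.continuousAt.eventually_lt continuousAt_const hp] with q hq γ hγ
  exact eq_solutionCurve L hK hq hγ

/-- The equation is linear in `a`, so a solution run backwards solves the equation for `-a`;
uniqueness does the rest. This is what makes transport invertible. -/
theorem solutionCurve_reverse (L : C(E, F →L[ℝ] E)) {K : NNReal} (hK : LipschitzWith K L)
    {x : E} {a : F} (ha : K * ‖a‖₊ < 1) :
    solutionCurve L (solutionCurve L (x, a) 1, -a) =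
      (solutionCurve L (x, a)).comp ⟨unitInterval.symm, unitInterval.continuous_symm⟩ := by
  set γ := solutionCurve L (x, a) with hγ
  have hfix : ∀ t : unitInterval, x + ∫ s in (0 : ℝ)..t, L (extendCurve γ s) a = γ t := by
    intro t
    rw [← picardMap_apply, hγ, picardMap_solutionCurve L hK ha]
  symm
  refine eq_solutionCurve L hK (by simpa using ha) ?_
  ext t
  rw [picardMap_apply]
  set g : ℝ → E := fun s => L (extendCurve γ s) a with hg
  have hgc : Continuous g :=
    (L.continuous.comp (continuous_extendCurve γ)).clm_apply continuous_const
  have e1 : ∫ s in (0 : ℝ)..t, L (extendCurve (γ.comp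
      ⟨unitInterval.symm, unitInterval.continuous_symm⟩) s) (-a)
      = ∫ s in (0 : ℝ)..t, - g (1 - s) := by
    refine intervalIntegral.integral_congr fun s hs => ?_
    rw [uIcc_of_le t.2.1] at hs
    have hs1 : s ∈ Icc (0 : ℝ) 1 := ⟨hs.1, hs.2.trans t.2.2⟩
    have hs2 : 1 - s ∈ Icc (0 : ℝ) 1 := ⟨by linarith [hs1.2], by linarith [hs1.1]⟩
    have e : extendCurve (γ.comp ⟨unitInterval.symm, unitInterval.continuous_symm⟩) s
        = extendCurve γ (1 - s) := by
      simp only [extendCurve, ContinuousMap.comp_apply, ContinuousMap.coe_mk]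
      rw [projIcc_of_mem _ hs1, projIcc_of_mem _ hs2]
      rfl
    simp only [e, map_neg, hg]
  rw [e1, intervalIntegral.integral_neg, intervalIntegral.integral_comp_sub_left g 1]
  have h1 := hfix 1
  have h2 := hfix (unitInterval.symm t)
  simp only [unitInterval.coe_symm_eq, Icc.coe_one] at h1 h2
  have h3 := intervalIntegral.integral_add_adjacent_intervals
    (hgc.intervalIntegrable (μ := MeasureTheory.volume) 0 (1 - (t : ℝ)))
    (hgc.intervalIntegrable (1 - (t : ℝ)) 1)
  change γ 1 + _ = γ (unitInterval.symm t)
  rw [← h1, ← h2, ← h3, sub_zero]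
  abel

theorem hasDerivWithinAt_solutionCurve (L : C(E, F →L[ℝ] E)) {K : NNReal}
    (hK : LipschitzWith K L) {x : E} {a : F} (ha : K * ‖a‖₊ < 1) {t : ℝ} (ht : t ∈ Icc (0 : ℝ) 1) :
    HasDerivWithinAt (extendCurve (solutionCurve L (x, a)))
      (L (extendCurve (solutionCurve L (x, a)) t) a) (Icc 0 1) t := by
  set γ := solutionCurve L (x, a) with hγ
  have hgc : Continuous fun s => L (extendCurve γ s) a :=
    (L.continuous.comp (continuous_extendCurve γ)).clm_apply continuous_const
  have hd : HasDerivAt (fun t => x + ∫ s in (0 : ℝ)..t, L (extendCurve γ s) a)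
      (L (extendCurve γ t) a) t :=
    (intervalIntegral.integral_hasDerivAt_right (hgc.intervalIntegrable _ _)
      hgc.aestronglyMeasurable.stronglyMeasurableAtFilter hgc.continuousAt).const_add x
  have hfix : ∀ t ∈ Icc (0 : ℝ) 1,
      extendCurve γ t = x + ∫ s in (0 : ℝ)..t, L (extendCurve γ s) a := by
    intro t ht
    have : picardMap L ((x, a), γ) ⟨t, ht⟩ = γ ⟨t, ht⟩ := by
      rw [hγ, picardMap_solutionCurve L hK ha]
    rw [picardMap_apply] at this
    rw [this, extendCurve, projIcc_of_mem _ ht]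
  exact hd.hasDerivWithinAt.congr hfix (hfix t ht)

theorem solutionCurve_zero_right (L : C(E, F →L[ℝ] E)) {K : NNReal} (hK : LipschitzWith K L)
    (x : E) : solutionCurve L (x, 0) = constCurve E x := by
  symm
  refine eq_solutionCurve L hK (by simp) ?_
  ext t
  simp [picardMap_apply]

theorem solutionCurve_zero (L : C(E, F →L[ℝ] E)) {K : NNReal} (hK : LipschitzWith K L)
    {x : E} {a : F} (ha : K * ‖a‖₊ < 1) : solutionCurve L (x, a) 0 = x := by
  rw [← picardMap_solutionCurve L hK ha, picardMap_apply]
  simp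

/-- A curve whose velocity vanishes whenever it is close to `c` is constant as soon as it passes
through `c`. -/
theorem eq_const_of_locally_stationary {f : ℝ → E} {c : E} {W : Set E} (hW : W ∈ 𝓝 c)
    (hf : ContinuousOn f (Icc 0 1))
    (hd : ∀ t ∈ Icc (0 : ℝ) 1, f t ∈ W → HasDerivWithinAt f 0 (Icc 0 1) t)
    {t₀ : ℝ} (ht₀ : t₀ ∈ Icc (0 : ℝ) 1) (h₀ : f t₀ = c) {t : ℝ} (ht : t ∈ Icc (0 : ℝ) 1) :
    f t = c := by
  have hcont : Continuous fun s : unitInterval => f s := continuousOn_iff_continuous_domRestrict.1 hf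
  -- The times at which `f = c` form a closed set, which is open because `f` has zero derivative
  -- while it stays in `W`; `[0, 1]` is connected.
  have hclopen : IsClopen {s : unitInterval | f s = c} := by
    refine ⟨isClosed_eq hcont continuous_const, ?_⟩
    rw [isOpen_iff_mem_nhds]
    intro s hs
    have h1 : (fun s : unitInterval => f s) ⁻¹' W ∈ 𝓝 s :=
      hcont.continuousAt.preimage_mem_nhds (by rw [mem_ofPred_eq] at hs; rwa [hs])
    obtain ⟨r, hr, hrW⟩ := Metric.mem_nhds_iff.1 h1
    filter_upwards [Metric.ball_mem_nhds s hr] with s' hs'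
    have key := Convex.norm_image_sub_le_of_norm_hasDerivWithin_le (𝕜 := ℝ) (f := f)
      (f' := fun _ => 0) (s := Icc 0 1 ∩ ball (s : ℝ) r) (C := 0) (x := (s : ℝ)) (y := (s' : ℝ))
      (fun x hx => (hd x hx.1 (hrW (show (⟨x, hx.1⟩ : unitInterval) ∈ ball s r from hx.2))).mono
        inter_subset_left)
      (by simp) ((convex_Icc 0 1).inter (convex_ball _ _)) ⟨s.2, mem_ball_self hr⟩ ⟨s'.2, hs'⟩
    rw [zero_mul, norm_le_zero_iff, sub_eq_zero] at key
    exact key.trans hs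
  have := hclopen.eq_univ ⟨⟨t₀, ht₀⟩, h₀⟩
  have hmem : (⟨t, ht⟩ : unitInterval) ∈ {s : unitInterval | f s = c} := this ▸ mem_univ _
  exact hmem

end Flow

/-! ### Smooth local right inverses of surjective operators -/

section LocalSections

variable {E F : Type*} [NormedAddCommGroup E] [NormedSpace ℝ E]
  [NormedAddCommGroup F] [NormedSpace ℝ F] [FiniteDimensional ℝ F]

/-- A smooth family of operators has a smooth family of right inverses near every point at which
it is surjective. -/
theorem exists_local_rightInverse {A : E → E →L[ℝ] F} {U : Set E} (hU : IsOpen U)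
    (hA : ContDiffOn ℝ ∞ A U) {x : E} (hx : x ∈ U) (hsurj : Function.Surjective (A x)) :
    ∃ V : Set E, IsOpen V ∧ x ∈ V ∧ V ⊆ U ∧ ∃ B : E → F →L[ℝ] E, ContDiffOn ℝ ∞ B V ∧
      ∀ y ∈ V, ∀ w, A y (B y w) = w := by
  have : CompleteSpace F := FiniteDimensional.complete ℝ F
  obtain ⟨B₀, hB₀⟩ := (A x).exists_rightInverse_of_surjective (LinearMap.range_eq_top.2 hsurj)
  -- With `B₀` a right inverse at `x`, the operator `A y ∘ B₀` is the identity at `y = x`, hence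
  -- invertible nearby, and `B₀ ∘ (A y ∘ B₀)⁻¹` is a right inverse at `y`.
  set S : E → F →L[ℝ] F := fun y => (A y).comp B₀ with hS
  have hSs : ContDiffOn ℝ ∞ S U := hA.clm_comp contDiffOn_const
  have hSx : IsUnit (S x) := by
    rw [hS]
    simp only [hB₀]
    exact isUnit_one
  set V := U ∩ S ⁻¹' {u | IsUnit u} with hV
  have hVo : IsOpen V := hSs.continuousOn.isOpen_inter_preimage hU Units.isOpen
  refine ⟨V, hVo, ⟨hx, hSx⟩, inter_subset_left,
    fun y => B₀.comp (Ring.inverse (S y)), ?_, ?_⟩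
  · intro y hy
    obtain ⟨u, hu⟩ : IsUnit (S y) := hy.2
    have h1 : ContDiffAt ℝ ∞ Ring.inverse (S y) := hu ▸ contDiffAt_ringInverse ℝ u
    have h2 : ContDiffAt ℝ ∞ S y := hSs.contDiffAt (hU.mem_nhds hy.1)
    exact (contDiffAt_const.clm_comp (h1.comp y h2)).contDiffWithinAt
  · intro y hy w
    obtain hu : IsUnit (S y) := hy.2
    have := Ring.mul_inverse_cancel _ hu
    exact congrArg (fun T : F →L[ℝ] F => T w) this

theorem isOpen_setOf_surjective {A : E → E →L[ℝ] F} {U : Set E} (hU : IsOpen U)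
    (hA : ContDiffOn ℝ ∞ A U) : IsOpen {x | x ∈ U ∧ Function.Surjective (A x)} := by
  rw [isOpen_iff_mem_nhds]
  rintro x ⟨hx, hs⟩
  obtain ⟨V, hV, hxV, hVU, B, -, hB⟩ := exists_local_rightInverse hU hA hx hs
  filter_upwards [hV.mem_nhds hxV] with y hy
  exact ⟨hVU hy, fun w => ⟨B y w, hB y hy w⟩⟩

end LocalSections

/-! ### Lifting segments: transport preserving the ball and its boundary -/

section Transport

universe u

variable {E F : Type u} [NormedAddCommGroup E] [InnerProductSpace ℝ E] [FiniteDimensional ℝ E]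
  [NormedAddCommGroup F] [NormedSpace ℝ F] [FiniteDimensional ℝ F]

/-- The map `G` and, along the sphere of radius `ε`, its restriction to the sphere are submersive
at the points of the closed ball of radius `ε` lying over `C`. -/
structure SubmersiveOver (G : E → F) (ε : ℝ) (C : Set F) : Prop where
  ball : ∀ x ∈ closedBall (0 : E) ε, G x ∈ C → Function.Surjective (fderiv ℝ G x)
  sphere : ∀ x ∈ sphere (0 : E) ε, G x ∈ C →
    Function.Surjective ((fderiv ℝ G x).prod (innerSL ℝ x))

theorem SubmersiveOver.mono {G : E → F} {ε : ℝ} {C C' : Set F} (h : SubmersiveOver G ε C)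
    (hC : C' ⊆ C) : SubmersiveOver G ε C' :=
  ⟨fun x hx hG => h.ball x hx (hC hG), fun x hx hG => h.sphere x hx (hC hG)⟩

/-- Vectors in the target lift smoothly to vector fields which are tangent to all spheres of radius
close to `ε`. -/
theorem exists_lift {G : E → F} {U : Set E} (hU : IsOpen U) (hG : ContDiffOn ℝ ∞ G U) {ε : ℝ}
    (hεU : closedBall 0 ε ⊆ U) {C : Set F} (hC : IsClosed C) (hS : SubmersiveOver G ε C) :
    ∃ L : E → F →L[ℝ] E, ContDiff ℝ ∞ L ∧ HasCompactSupport L ∧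
      (∀ x ∈ closedBall (0 : E) ε, G x ∈ C → ∀ a, fderiv ℝ G x (L x a) = a) ∧
      ∃ η > 0, ∀ x, |‖x‖ ^ 2 - ε ^ 2| ≤ η → ∀ a, inner ℝ x (L x a) = 0 := by
  have hdG : ContDiffOn ℝ ∞ (fderiv ℝ G) U := hG.fderiv_of_isOpen hU (by simp)
  set A₂ : E → E →L[ℝ] F × ℝ := fun x => (fderiv ℝ G x).prod (innerSL ℝ x) with hA₂
  have hA₂s : ContDiffOn ℝ ∞ A₂ U := by
    have h1 : ContDiffOn ℝ ∞ (fun x : E => innerSL ℝ x) U := (innerSL ℝ).contDiff.contDiffOn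
    have e : A₂ = fun x => (ContinuousLinearMap.inl ℝ F ℝ).comp (fderiv ℝ G x) +
        (ContinuousLinearMap.inr ℝ F ℝ).comp (innerSL ℝ x) := by
      ext x v <;> simp [hA₂]
    rw [e]
    exact (contDiffOn_const.clm_comp hdG).add (contDiffOn_const.clm_comp h1)
  set K : Set E := closedBall 0 ε ∩ G ⁻¹' C with hK
  have hKc : IsCompact K := by
    have : IsClosed K := (hG.continuousOn.mono hεU).preimage_isClosed_of_isClosed
      isClosed_closedBall hC
    exact (isCompact_closedBall (0 : E) ε).of_isClosed_subset this inter_subset_left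
  set O : Set E := {x | x ∈ U ∧ Function.Surjective (A₂ x)} with hO
  have hOo : IsOpen O := isOpen_setOf_surjective hU hA₂s
  have hq : Continuous fun x : E => |‖x‖ ^ 2 - ε ^ 2| := by fun_prop
  -- The points of `K` where `A₂` is not surjective form a compact set missing the sphere, so `|‖x‖²
  -- - ε²|` has a positive lower bound there.
  obtain ⟨η, hη, hηK⟩ := (hKc.diff hOo).exists_forall_le' (a := 0) hq.continuousOn (by
    intro x hx
    rw [abs_pos, sub_ne_zero]
    intro h
    apply hx.2
    have hxε : ‖x‖ ≤ ε := mem_closedBall_zero_iff.1 hx.1.1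
    have : ‖x‖ = ε := by
      rwa [sq_eq_sq₀ (norm_nonneg x) ((norm_nonneg x).trans hxε)] at h
    exact ⟨hεU hx.1.1, hS.sphere x (mem_sphere_zero_iff_norm.2 this) hx.1.2⟩)
  -- All three conditions are convex, so local solutions glue by a partition of unity; the last one
  -- forces compact support. Locally on `K` one takes a right inverse of `A₂` near the sphere and of
  -- `dG` away from it; off `K` one takes zero.
  set t : E → Set (F →L[ℝ] E) := fun x => {L | (x ∈ K → ∀ a, fderiv ℝ G x (L a) = a) ∧
    (|‖x‖ ^ 2 - ε ^ 2| ≤ η / 2 → ∀ a, inner ℝ x (L a) = 0) ∧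
    (x ∉ closedBall (0 : E) (ε + 1) → L = 0)} with ht
  have hconv : ∀ x, Convex ℝ (t x) := by
    intro x L₁ h₁ L₂ h₂ a b _ _ hab
    refine ⟨fun hx w => ?_, fun hx w => ?_, fun hx => ?_⟩
    · simp [h₁.1 hx, h₂.1 hx, ← add_smul, hab]
    · simp [inner_add_right, inner_smul_right, h₁.2.1 hx, h₂.2.1 hx]
    · simp [h₁.2.2 hx, h₂.2.2 hx]
  have hloc : ∀ x : E, ∃ V ∈ 𝓝 x, ∃ g : E → F →L[ℝ] E,
      ContMDiffOn (modelWithCornersSelf ℝ E) (modelWithCornersSelf ℝ (F →L[ℝ] E)) ∞ g V ∧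
        ∀ y ∈ V, g y ∈ t y := by
    intro x
    simp only [contMDiffOn_iff_contDiffOn]
    by_cases hxK : x ∈ K
    · have hxb : ball (0 : E) (ε + 1) ∈ 𝓝 x := isOpen_ball.mem_nhds (by
        have := mem_closedBall_zero_iff.1 hxK.1
        exact mem_ball_zero_iff.2 (by linarith))
      by_cases hxη : |‖x‖ ^ 2 - ε ^ 2| ≤ η / 2
      · have hxO : x ∈ O := by
          by_contra h
          have := hηK x ⟨hxK, h⟩
          linarith
        obtain ⟨V, hV, hxV, hVU, B, hB, hAB⟩ := exists_local_rightInverse hU hA₂s hxO.1 hxO.2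
        refine ⟨V ∩ ball 0 (ε + 1), Filter.inter_mem (hV.mem_nhds hxV) hxb,
          fun y => (B y).comp (ContinuousLinearMap.inl ℝ F ℝ),
          (hB.clm_comp contDiffOn_const).mono inter_subset_left, fun y hy => ⟨?_, ?_, ?_⟩⟩
        · intro _ a
          exact congrArg Prod.fst (hAB y hy.1 (a, 0))
        · intro _ a
          exact congrArg Prod.snd (hAB y hy.1 (a, 0))
        · intro h
          exact absurd (ball_subset_closedBall hy.2) h
      · obtain ⟨V, hV, hxV, hVU, B, hB, hAB⟩ := exists_local_rightInverse hU hdG (hεU hxK.1)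
          (hS.ball x hxK.1 hxK.2)
        refine ⟨V ∩ {y | η / 2 < |‖y‖ ^ 2 - ε ^ 2|} ∩ ball 0 (ε + 1),
          Filter.inter_mem (Filter.inter_mem (hV.mem_nhds hxV)
            ((isOpen_lt continuous_const hq).mem_nhds (not_le.1 hxη))) hxb, B,
          hB.mono (inter_subset_left.trans inter_subset_left), fun y hy => ⟨?_, ?_, ?_⟩⟩
        · intro _ a
          exact hAB y hy.1.1 a
        · intro h
          exact absurd h (not_le.2 hy.1.2)
        · intro h
          exact absurd (ball_subset_closedBall hy.2) h
    · refine ⟨Kᶜ, hKc.isClosed.isOpen_compl.mem_nhds hxK, fun _ => 0, contDiffOn_const,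
        fun y hy => ⟨fun h => absurd h hy, fun _ a => by simp, fun _ => rfl⟩⟩
  obtain ⟨L, hL⟩ := exists_contMDiffMap_forall_mem_convex_of_local
    (modelWithCornersSelf ℝ E) (n := ⊤) hconv hloc
  refine ⟨L, contMDiff_iff_contDiff.1 L.contMDiff,
    HasCompactSupport.intro (isCompact_closedBall (0 : E) (ε + 1)) fun x hx => (hL x).2.2 hx,
    fun x hx hxC => (hL x).1 ⟨hx, hxC⟩, η / 2, half_pos hη, fun x hx => (hL x).2.1 hx⟩

/-- `T x a` is the endpoint of a lift of the segment from `G x` to `G x + a`, provided that this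
segment stays in the interior of `C`; for `‖a‖ < R` the map `T · a` is a diffeomorphism preserving
the ball and the sphere of radius `ε`. -/
structure IsTransport (G : E → F) (ε : ℝ) (C : Set F) (R : ℝ) (T : E → F → E) : Prop where
  smooth : ContDiffOn ℝ ∞ (fun p : E × F => T p.1 p.2) {p | ‖p.2‖ < R}
  zero : ∀ x, T x 0 = x
  inv : ∀ x a, ‖a‖ < R → T (T x a) (-a) = x
  ball : ∀ x a, ‖a‖ < R → x ∈ ball (0 : E) ε → T x a ∈ ball (0 : E) ε
  sphere : ∀ x a, ‖a‖ < R → x ∈ sphere (0 : E) ε → T x a ∈ sphere (0 : E) ε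
  lift : ∀ x a, ‖a‖ < R → x ∈ closedBall (0 : E) ε →
    (∀ s ∈ Icc (0 : ℝ) 1, G x + s • a ∈ interior C) → G (T x a) = G x + a

/-- The derivative of `‖c‖²` is `2⟪c, c'⟫`, which vanishes while `‖c‖²` is near `ε²`; hence a curve
that meets the sphere never leaves it, forwards or backwards. -/
theorem norm_eq_of_tangent {ε η : ℝ} (hη : 0 < η) {c c' : ℝ → E}
    (hc : ∀ t ∈ Icc (0 : ℝ) 1, HasDerivWithinAt c (c' t) (Icc 0 1) t)
    (htan : ∀ t ∈ Icc (0 : ℝ) 1, |‖c t‖ ^ 2 - ε ^ 2| ≤ η → inner ℝ (c t) (c' t) = 0)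
    {t₀ t : ℝ} (ht₀ : t₀ ∈ Icc (0 : ℝ) 1) (ht : t ∈ Icc (0 : ℝ) 1) (h : ‖c t₀‖ = ε) :
    ‖c t‖ = ε := by
  have hε : 0 ≤ ε := h ▸ norm_nonneg _
  have hcc : ContinuousOn c (Icc 0 1) := fun t ht => (hc t ht).continuousWithinAt
  have := eq_const_of_locally_stationary (f := fun t => ‖c t‖ ^ 2) (c := ε ^ 2)
    (closedBall_mem_nhds _ hη) (hcc.norm.pow 2) (fun t ht htW => by
      have h1 := (hc t ht).norm_sq
      rw [htan t ht (by rwa [mem_closedBall, Real.dist_eq] at htW), mul_zero] at h1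
      exact h1) ht₀ (by rw [h]) ht
  rwa [sq_eq_sq₀ (norm_nonneg _) hε] at this

/-- To get out, the curve would have to meet the sphere, and then it would have started on it. -/
theorem norm_lt_of_tangent {ε η : ℝ} (hη : 0 < η) {c c' : ℝ → E}
    (hc : ∀ t ∈ Icc (0 : ℝ) 1, HasDerivWithinAt c (c' t) (Icc 0 1) t)
    (htan : ∀ t ∈ Icc (0 : ℝ) 1, |‖c t‖ ^ 2 - ε ^ 2| ≤ η → inner ℝ (c t) (c' t) = 0)
    {t : ℝ} (ht : t ∈ Icc (0 : ℝ) 1) (h : ‖c 0‖ < ε) : ‖c t‖ < ε := by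
  have hcc : ContinuousOn c (Icc 0 1) := fun t ht => (hc t ht).continuousWithinAt
  by_contra hcon
  rw [not_lt] at hcon
  obtain ⟨s, hs, hsε⟩ := intermediate_value_Icc ht.1
    (hcc.norm.mono (Icc_subset_Icc_right ht.2)) ⟨h.le, hcon⟩
  have := norm_eq_of_tangent hη hc htan (t₀ := s) (t := 0) ⟨hs.1, hs.2.trans ht.2⟩
    ⟨le_rfl, zero_le_one⟩ hsε
  exact h.ne this

theorem exists_small_transport {G : E → F} {U : Set E} (hU : IsOpen U) (hG : ContDiffOn ℝ ∞ G U)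
    {ε : ℝ} (hεU : closedBall 0 ε ⊆ U) {C : Set F} (hC : IsClosed C)
    (hS : SubmersiveOver G ε C) : ∃ R > 0, ∃ T, IsTransport G ε C R T := by
  have : CompleteSpace E := FiniteDimensional.complete ℝ E
  have : CompleteSpace F := FiniteDimensional.complete ℝ F
  obtain ⟨L, hLs, hLc, hLift, η, hη, htan⟩ := exists_lift hU hG hεU hC hS
  -- Compact support makes `L` globally Lipschitz. The radius `1 / (K + 1)` ensures `K * ‖a‖ < 1`
  -- and is defined even if `K = 0`.
  obtain ⟨K, hK⟩ := ContDiff.lipschitzWith_of_hasCompactSupport hLc hLs (by simp)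
  set M : C(E, F →L[ℝ] E) := ⟨L, hLs.continuous⟩ with hM
  have hKM : LipschitzWith K M := hK
  have hKp : (0 : ℝ) < K + 1 := by positivity
  have hsmall : ∀ a : F, ‖a‖ < 1 / (K + 1) → K * ‖a‖₊ < 1 := by
    intro a ha
    rw [lt_div_iff₀ hKp] at ha
    have : (K : ℝ) * ‖a‖ < 1 := by nlinarith [norm_nonneg a]
    exact_mod_cast this
  have hder : ∀ x a, ‖a‖ < 1 / (K + 1) → ∀ t ∈ Icc (0 : ℝ) 1,
      HasDerivWithinAt (extendCurve (solutionCurve M (x, a)))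
        (L (extendCurve (solutionCurve M (x, a)) t) a) (Icc 0 1) t :=
    fun x a ha t ht => hasDerivWithinAt_solutionCurve M hKM (hsmall a ha) ht
  have hone : ∀ γ : C(unitInterval, E), extendCurve γ 1 = γ 1 := fun γ => extendCurve_coe γ 1
  have hzero : ∀ x a, ‖a‖ < 1 / (K + 1) → extendCurve (solutionCurve M (x, a)) 0 = x :=
    fun x a ha => (extendCurve_coe _ 0).trans (solutionCurve_zero M hKM (hsmall a ha))
  have h01 : (0 : ℝ) ∈ Icc (0 : ℝ) 1 := ⟨le_rfl, zero_le_one⟩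
  have h11 : (1 : ℝ) ∈ Icc (0 : ℝ) 1 := ⟨zero_le_one, le_rfl⟩
  have hball : ∀ x a, ‖a‖ < 1 / (K + 1) → ‖x‖ < ε → ∀ t ∈ Icc (0 : ℝ) 1,
      ‖extendCurve (solutionCurve M (x, a)) t‖ < ε := fun x a ha hx t ht =>
    norm_lt_of_tangent hη (hder x a ha) (fun t _ h => htan _ h a) ht (by rwa [hzero x a ha])
  have hsphere : ∀ x a, ‖a‖ < 1 / (K + 1) → ‖x‖ = ε → ∀ t ∈ Icc (0 : ℝ) 1,
      ‖extendCurve (solutionCurve M (x, a)) t‖ = ε := fun x a ha hx t ht =>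
    norm_eq_of_tangent hη (hder x a ha) (fun t _ h => htan _ h a) h01 ht (by rwa [hzero x a ha])
  refine ⟨1 / (K + 1), by positivity, fun x a => solutionCurve M (x, a) 1, ?_, ?_, ?_, ?_, ?_, ?_⟩
  · intro p hp
    have h1 := contDiffAt_solutionCurve M hLs hKM (hsmall p.2 hp)
    have h2 := (ContinuousMap.evalCLM (M := E) ℝ (1 : unitInterval)).contDiff (n := ∞)
    exact (h2.contDiffAt.comp p h1).contDiffWithinAt
  · intro x
    simp [solutionCurve_zero_right M hKM]
  · intro x a ha
    rw [solutionCurve_reverse M hKM (hsmall a ha)]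
    simpa using solutionCurve_zero M hKM (x := x) (hsmall a ha)
  · intro x a ha hx
    rw [mem_ball_zero_iff] at hx ⊢
    rw [← hone]
    exact hball x a ha hx 1 h11
  · intro x a ha hx
    rw [mem_sphere_zero_iff_norm] at hx ⊢
    rw [← hone]
    exact hsphere x a ha hx 1 h11
  · intro x a ha hx hseg
    set c := extendCurve (solutionCurve M (x, a)) with hc
    have hcball : ∀ t ∈ Icc (0 : ℝ) 1, c t ∈ closedBall (0 : E) ε := by
      intro t ht
      rw [mem_closedBall_zero_iff] at hx ⊢
      rcases hx.lt_or_eq with h | h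
      · exact (hball x a ha h t ht).le
      · exact (hsphere x a ha h t ht).le
    have hcomp : IsCompact ((fun s : ℝ => G x + s • a) '' Icc 0 1) :=
      isCompact_Icc.image (by fun_prop)
    -- A whole `r`-neighbourhood of the compact segment lies in the interior of `C`. As long as `G
    -- (c t) - t • a` is `r`-close to `G x`, the lifting property holds at `c t` and this difference
    -- is stationary, so it is constant.
    obtain ⟨r, hr, hrC⟩ := hcomp.exists_thickening_subset_open (isOpen_interior (s := C))
      (by rintro _ ⟨s, hs, rfl⟩; exact hseg s hs)
    have hGd : ∀ t ∈ Icc (0 : ℝ) 1, HasDerivWithinAt (fun t => G (c t) - t • a)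
        (fderiv ℝ G (c t) (L (c t) a) - a) (Icc 0 1) t := by
      intro t ht
      have h1 : HasFDerivAt G (fderiv ℝ G (c t)) (c t) :=
        ((hG.contDiffAt (hU.mem_nhds (hεU (hcball t ht)))).differentiableAt
          (by simp)).hasFDerivAt
      have h2 := h1.comp_hasDerivWithinAt t (hder x a ha t ht)
      have h3 : HasDerivWithinAt (fun t : ℝ => t • a) a (Icc 0 1) t := by
        simpa using (hasDerivWithinAt_id t (Icc (0 : ℝ) 1)).smul_const a
      exact h2.sub h3
    have := eq_const_of_locally_stationary (f := fun t => G (c t) - t • a) (c := G x)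
      (ball_mem_nhds _ hr) (fun t ht => (hGd t ht).continuousWithinAt) (fun t ht htW => by
        have hmem : G (c t) ∈ C := by
          refine interior_subset (hrC ?_)
          rw [mem_thickening_iff]
          refine ⟨G x + t • a, ⟨t, ht, rfl⟩, ?_⟩
          rw [mem_ball, dist_eq_norm] at htW
          rwa [dist_eq_norm, sub_add_eq_sub_sub_swap]
        have h1 := hGd t ht
        rwa [hLift _ (hcball t ht) hmem, sub_self] at h1) h01
      (by simp only [hc, hzero x a ha, zero_smul, sub_zero]) h11
    rw [← hone, ← hc]
    rw [one_smul] at this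
    exact sub_eq_iff_eq_add.1 this

/-- `N` steps along `a / N` cover the segment piece by piece, each step starting over the point
where the previous one ended. Only `a / N` must be small, so the admissible range grows by the
factor `N`. -/
theorem IsTransport.iterate {G : E → F} {ε : ℝ} {C : Set F} {R : ℝ} {T : E → F → E}
    (h : IsTransport G ε C R T) {N : ℕ} (hN : 0 < N) :
    IsTransport G ε C (N * R) (fun x a => (fun z => T z ((N : ℝ)⁻¹ • a))^[N] x) := by
  have hN' : (0 : ℝ) < N := by exact_mod_cast hN
  have hsmall : ∀ a : F, ‖a‖ < N * R → ‖(N : ℝ)⁻¹ • a‖ < R := by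
    intro a ha
    rw [norm_smul, norm_inv, Real.norm_of_nonneg hN'.le, inv_mul_lt_iff₀ hN']
    exact ha
  have hb : ∀ a : F, ‖a‖ < N * R → MapsTo (fun z => T z ((N : ℝ)⁻¹ • a)) (closedBall 0 ε)
      (closedBall 0 ε) := by
    intro a ha x hx
    rw [← ball_union_sphere] at hx ⊢
    exact hx.imp (h.ball x _ (hsmall a ha)) (h.sphere x _ (hsmall a ha))
  refine ⟨?_, ?_, ?_, ?_, ?_, ?_⟩
  · have key : ∀ j : ℕ, ContDiffOn ℝ ∞
        (fun p : E × F => (fun z => T z ((N : ℝ)⁻¹ • p.2))^[j] p.1) {p | ‖p.2‖ < N * R} := by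
      intro j
      induction j with
      | zero => exact contDiff_fst.contDiffOn
      | succ j ih =>
        simp only [Function.iterate_succ_apply']
        have h2 : ContDiffOn ℝ ∞ (fun p : E × F => (N : ℝ)⁻¹ • p.2) {p | ‖p.2‖ < N * R} :=
          (contDiff_snd.const_smul _).contDiffOn
        exact h.smooth.comp (ih.prodMk h2) fun p hp => hsmall p.2 hp
    exact key N
  · intro x
    simp only [smul_zero]
    exact Function.iterate_fixed (h.zero x) N
  · intro x a ha
    have : Function.LeftInverse (fun z => T z ((N : ℝ)⁻¹ • -a))
        (fun z => T z ((N : ℝ)⁻¹ • a)) := by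
      intro z
      simp only [smul_neg]
      exact h.inv z _ (hsmall a ha)
    exact this.iterate N x
  · intro x a ha hx
    exact MapsTo.iterate (fun z hz => h.ball z _ (hsmall a ha) hz) N hx
  · intro x a ha hx
    exact MapsTo.iterate (fun z hz => h.sphere z _ (hsmall a ha) hz) N hx
  · intro x a ha hx hseg
    have key : ∀ j : ℕ, j ≤ N → G ((fun z => T z ((N : ℝ)⁻¹ • a))^[j] x)
        = G x + ((j : ℝ) / N) • a := by
      intro j
      induction j with
      | zero => simp
      | succ j ih =>
        intro hj
        have ihj := ih (by omega)
        have hjN : (j : ℝ) + 1 ≤ N := by exact_mod_cast hj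
        rw [Function.iterate_succ_apply', h.lift _ _ (hsmall a ha) ((hb a ha).iterate j hx), ihj,
          add_assoc, ← add_smul]
        · congr 2
          push_cast
          field_simp
        · intro s hs
          rw [ihj, add_assoc, smul_smul, ← add_smul]
          refine hseg _ ⟨?_, ?_⟩
          · have := hs.1
            positivity
          · rw [← div_eq_mul_inv, ← add_div, div_le_one hN']
            linarith [hs.2]
    have := key N le_rfl
    rwa [div_self hN'.ne', one_smul] at this

theorem IsTransport.mono {G : E → F} {ε : ℝ} {C : Set F} {R R' : ℝ} {T : E → F → E}
    (h : IsTransport G ε C R T) (hR : R' ≤ R) : IsTransport G ε C R' T :=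
  ⟨h.smooth.mono fun _ hp => lt_of_lt_of_le hp hR, h.zero,
    fun x a ha => h.inv x a (ha.trans_le hR), fun x a ha => h.ball x a (ha.trans_le hR),
    fun x a ha => h.sphere x a (ha.trans_le hR), fun x a ha => h.lift x a (ha.trans_le hR)⟩

theorem exists_transport {G : E → F} {U : Set E} (hU : IsOpen U) (hG : ContDiffOn ℝ ∞ G U)
    {ε : ℝ} (hεU : closedBall 0 ε ⊆ U) {C : Set F} (hC : IsClosed C)
    (hS : SubmersiveOver G ε C) (R : ℝ) : ∃ T, IsTransport G ε C R T := by
  obtain ⟨r, hr, T, hT⟩ := exists_small_transport hU hG hεU hC hS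
  obtain ⟨N, hN⟩ := exists_nat_gt (R / r)
  refine ⟨_, (hT.iterate (N := N + 1) N.succ_pos).mono ?_⟩
  rw [div_lt_iff₀ hr] at hN
  push_cast
  nlinarith

theorem IsTransport.closedBall {G : E → F} {ε : ℝ} {C : Set F} {R : ℝ} {T : E → F → E}
    (h : IsTransport G ε C R T) {x : E} {a : F} (ha : ‖a‖ < R) (hx : x ∈ closedBall (0 : E) ε) :
    T x a ∈ closedBall (0 : E) ε := by
  rw [← ball_union_sphere] at hx ⊢
  exact hx.imp (h.ball x a ha) (h.sphere x a ha)

end Transport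

/-! ### Smooth maps and diffeomorphisms between arbitrary subsets -/

section SmoothMaps

variable {E F H : Type*} [NormedAddCommGroup E] [NormedSpace ℝ E]
  [NormedAddCommGroup F] [NormedSpace ℝ F] [NormedAddCommGroup H] [NormedSpace ℝ H]

theorem SmoothOnSet.mono {f : E → F} {S S' : Set E} (h : SmoothOnSet f S) (hS : S' ⊆ S) :
    SmoothOnSet f S' := fun x hx => by
  obtain ⟨V, hV, hxV, f', hf', he⟩ := h x (hS hx)
  exact ⟨V, hV, hxV, f', hf', fun y hy => he ⟨hS hy.1, hy.2⟩⟩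

theorem SmoothOnSet.of_contDiffOn {f : E → F} {S V : Set E} (hV : IsOpen V)
    (hf : ContDiffOn ℝ ∞ f V) (hS : S ⊆ V) : SmoothOnSet f S := fun _ hx =>
  ⟨V, hV, hS hx, f, hf, fun _ _ => rfl⟩

theorem SmoothOnSet.comp {f : E → F} {g : F → H} {S : Set E} {T : Set F}
    (hg : SmoothOnSet g T) (hf : SmoothOnSet f S) (hST : MapsTo f S T) :
    SmoothOnSet (g ∘ f) S := fun x hx => by
  obtain ⟨V, hV, hxV, f', hf', he⟩ := hf x hx
  obtain ⟨W, hW, hxW, g', hg', he'⟩ := hg (f x) (hST hx)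
  refine ⟨V ∩ f' ⁻¹' W, hf'.continuousOn.isOpen_inter_preimage hV hW, ⟨hxV, ?_⟩, g' ∘ f', ?_, ?_⟩
  · rw [mem_preimage, he ⟨hx, hxV⟩]
    exact hxW
  · exact hg'.comp (hf'.mono inter_subset_left) fun y hy => hy.2
  · rintro y ⟨hyS, hyV, hyW⟩
    rw [mem_preimage, he ⟨hyS, hyV⟩] at hyW
    simp only [Function.comp_apply]
    rw [he ⟨hyS, hyV⟩, he' ⟨hST hyS, hyW⟩]

theorem IsDiffeoOn.image_eq {f : E → F} {S : Set E} {T : Set F} (h : IsDiffeoOn f S T) :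
    f '' S = T := by
  obtain ⟨-, hm, g, -, hg, hinv⟩ := h
  exact Subset.antisymm hm.image_subset fun y hy => ⟨g y, hg hy, hinv.2 hy⟩

theorem IsDiffeoOn.injOn {f : E → F} {S : Set E} {T : Set F} (h : IsDiffeoOn f S T) :
    InjOn f S := by
  obtain ⟨-, -, g, -, -, hinv⟩ := h
  exact hinv.1.injOn

theorem IsDiffeoOn.restrict {f : E → F} {S S' : Set E} {T T' : Set F} (h : IsDiffeoOn f S T)
    (hS : S' ⊆ S) (hT : f '' S' = T') : IsDiffeoOn f S' T' := by
  obtain ⟨hf, hm, g, hg, hgm, hinv⟩ := h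
  subst hT
  have hsub : f '' S' ⊆ T := (image_mono hS).trans hm.image_subset
  refine ⟨hf.mono hS, mapsTo_image f S', g, hg.mono hsub, ?_, hinv.mono hS hsub⟩
  rintro _ ⟨x, hx, rfl⟩
  rwa [hinv.1 (hS hx)]

theorem IsDiffeoOn.comp {f : E → F} {g : F → H} {S : Set E} {T : Set F} {W : Set H}
    (hg : IsDiffeoOn g T W) (hf : IsDiffeoOn f S T) : IsDiffeoOn (g ∘ f) S W := by
  obtain ⟨hfs, hfm, f', hfs', hfm', hfi⟩ := hf
  obtain ⟨hgs, hgm, g', hgs', hgm', hgi⟩ := hg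
  exact ⟨hgs.comp hfs hfm, hgm.comp hfm, f' ∘ g', hfs'.comp hgs' hgm', hfm'.comp hgm',
    hfi.comp hgi hfm hgm'⟩

end SmoothMaps

/-! ### Formal properties of stratified fibrations and their diffeomorphisms -/

section Fibrations

variable {E F : Type*} [NormedAddCommGroup E] [NormedSpace ℝ E]
  [NormedAddCommGroup F] [NormedSpace ℝ F]

theorem image_trivialization_restrict {G : E → F} {A : Set E} {N N' V : Set F} {y : F}
    {Φ : E → F × E} (hN : N' ⊆ N) (hy : y ∈ N')
    (hΦ : Φ '' (A ∩ G ⁻¹' V) = (N ∩ V) ×ˢ (A ∩ G ⁻¹' {y}))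
    (hfst : ∀ x ∈ A ∩ G ⁻¹' V, (Φ x).1 = G x) :
    Φ '' (A ∩ G ⁻¹' N' ∩ G ⁻¹' V) = (N' ∩ V) ×ˢ (A ∩ G ⁻¹' N' ∩ G ⁻¹' {y}) := by
  ext q
  constructor
  · rintro ⟨x, ⟨⟨hxA, hxN⟩, hxV⟩, rfl⟩
    have h1 : Φ x ∈ (N ∩ V) ×ˢ (A ∩ G ⁻¹' {y}) := hΦ ▸ mem_image_of_mem Φ ⟨hxA, hxV⟩
    have h2 := hfst x ⟨hxA, hxV⟩
    refine ⟨⟨?_, h1.1.2⟩, ⟨h1.2.1, ?_⟩, h1.2.2⟩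
    · rw [h2]; exact hxN
    · have h3 : G (Φ x).2 = y := h1.2.2
      rw [mem_preimage, h3]; exact hy
  · rintro ⟨⟨hqN, hqV⟩, ⟨hqA, -⟩, hqy⟩
    have h1 : q ∈ Φ '' (A ∩ G ⁻¹' V) := hΦ ▸ ⟨⟨hN hqN, hqV⟩, hqA, hqy⟩
    obtain ⟨x, hx, rfl⟩ := h1
    refine ⟨x, ⟨⟨hx.1, ?_⟩, hx.2⟩, rfl⟩
    rw [mem_preimage, ← hfst x hx]
    exact hqN

/-- Locally trivial fibrations restrict to subsets of the base. -/
theorem IsLocallyTrivialFibration.restrict_base {G : E → F} {M bM : Set E} {N N' : Set F}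
    (h : IsLocallyTrivialFibration G M bM N) (hb : bM ⊆ M) (hN : N' ⊆ N) :
    IsLocallyTrivialFibration G (M ∩ G ⁻¹' N') (bM ∩ G ⁻¹' N') N' := by
  refine ⟨h.1.mono inter_subset_left, fun x hx => hx.2, fun y hy => ?_⟩
  obtain ⟨V, hV, hyV, Φ, hΦ, hfst, hint, hbd⟩ := h.2.2 y (hN hy)
  refine ⟨V, hV, hyV, Φ, hΦ.restrict (fun x hx => ⟨hx.1.1, hx.2⟩)
    (image_trivialization_restrict hN hy hΦ.image_eq hfst), fun x hx => hfst x ⟨hx.1.1, hx.2⟩,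
    ?_, image_trivialization_restrict hN hy hbd fun x hx => hfst x ⟨hb hx.1, hx.2⟩⟩
  have e : (M ∩ G ⁻¹' N') \ (bM ∩ G ⁻¹' N') = (M \ bM) ∩ G ⁻¹' N' := by
    ext x
    simp only [mem_sdiff, mem_inter_iff]
    tauto
  rw [e]
  exact image_trivialization_restrict hN hy hint fun x hx => hfst x ⟨hx.1.1, hx.2⟩

theorem IsLocallyTrivialFibration.interior {G : E → F} {M bM : Set E} {N : Set F}
    (h : IsLocallyTrivialFibration G M bM N) :
    IsLocallyTrivialFibration G (M \ bM) ∅ N := by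
  refine ⟨h.1.mono sdiff_subset, h.2.1.mono_left sdiff_subset, fun y hy => ?_⟩
  obtain ⟨V, hV, hyV, Φ, hΦ, hfst, hint, hbd⟩ := h.2.2 y hy
  exact ⟨V, hV, hyV, Φ, hΦ.restrict (fun x hx => ⟨hx.1.1, hx.2⟩) hint,
    fun x hx => hfst x ⟨hx.1.1, hx.2⟩, by simpa using hint, by simp⟩

theorem IsLocallyTrivialFibration.boundary {G : E → F} {M bM : Set E} {N : Set F}
    (h : IsLocallyTrivialFibration G M bM N) (hb : bM ⊆ M) :
    IsLocallyTrivialFibration G bM ∅ N := by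
  refine ⟨h.1.mono hb, h.2.1.mono_left hb, fun y hy => ?_⟩
  obtain ⟨V, hV, hyV, Φ, hΦ, hfst, hint, hbd⟩ := h.2.2 y hy
  exact ⟨V, hV, hyV, Φ, hΦ.restrict (fun x hx => ⟨hb hx.1, hx.2⟩) hbd,
    fun x hx => hfst x ⟨hb hx.1, hx.2⟩, by simpa using hbd, by simp⟩

/-- Curves in the base of a locally trivial fibration lift, so the fibration is a submersion. -/
theorem IsLocallyTrivialFibration.isSubmersionOn {G : E → F} {M : Set E} {N : Set F}
    (h : IsLocallyTrivialFibration G M ∅ N) : IsSubmersionOn G M N := by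
  refine ⟨h.1, h.2.1, ?_⟩
  rintro x hx w ⟨σ, ⟨hσ0, η, hη, hσs, hσN⟩, hσd⟩
  obtain ⟨V, hV, hyV, Φ, ⟨-, hΦm, g, hg, hgm, hinv⟩, hfst, -, -⟩ := h.2.2 (G x) (h.2.1 hx)
  have hxV : x ∈ M ∩ G ⁻¹' V := ⟨hx, hyV⟩
  set p := (Φ x).2 with hp
  have hΦx : (σ 0, p) = Φ x := by rw [hσ0, ← hfst x hxV]
  have hpM : p ∈ M ∩ G ⁻¹' {G x} := (hΦm hxV).2
  obtain ⟨W, hW, hxW, g', hg', he⟩ := hg (Φ x) (hΦm hxV)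
  have h0 : (0 : ℝ) ∈ Ioo (-η) η := ⟨by linarith, hη⟩
  -- In the trivialization the lift of `σ` keeps the fibre coordinate `p` of `x`. The inverse `g` is
  -- smooth only on a subset, so the lifted curve is written with its local extension `g'`.
  set c : ℝ → F × E := fun t => (σ t, p) with hc
  have hcs : ContDiffOn ℝ ∞ c (Ioo (-η) η) := hσs.prodMk contDiffOn_const
  have hopen : IsOpen (Ioo (-η) η ∩ c ⁻¹' (W ∩ Prod.fst ⁻¹' V)) :=
    hcs.continuousOn.isOpen_inter_preimage isOpen_Ioo (hW.inter (hV.preimage continuous_fst))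
  have hmem : (0 : ℝ) ∈ Ioo (-η) η ∩ c ⁻¹' (W ∩ Prod.fst ⁻¹' V) := by
    refine ⟨h0, ?_, ?_⟩
    · rw [hc]; simp only; rw [hΦx]; exact hxW
    · rw [hc]; simp only [mem_preimage]; rw [hσ0]; exact hyV
  obtain ⟨r, hr, hrsub⟩ := Metric.isOpen_iff.1 hopen 0 hmem
  rw [Real.ball_eq_Ioo, zero_sub, zero_add] at hrsub
  have hcT : ∀ t ∈ Ioo (-r) r, c t ∈ (N ∩ V) ×ˢ (M ∩ G ⁻¹' {G x}) := fun t ht =>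
    ⟨⟨hσN t (hrsub ht).1, (hrsub ht).2.2⟩, hpM⟩
  have hgc : ∀ t ∈ Ioo (-r) r, g' (c t) = g (c t) := fun t ht =>
    he ⟨hcT t ht, (hrsub ht).2.1⟩
  have hr0 : (0 : ℝ) ∈ Ioo (-r) r := ⟨by linarith, hr⟩
  refine ⟨fun t => g' (c t), ⟨?_, r, hr, ?_, ?_⟩, ?_⟩
  · change g' (c 0) = x
    rw [hgc 0 hr0, hc]
    simp only
    rw [hΦx, hinv.1 hxV]
  · exact hg'.comp (hcs.mono fun t ht => (hrsub ht).1) fun t ht => (hrsub ht).2.1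
  · intro t ht
    change g' (c t) ∈ M
    rw [hgc t ht]
    exact (hgm (hcT t ht)).1
  · refine hσd.congr_of_eventuallyEq ?_
    filter_upwards [isOpen_Ioo.mem_nhds hr0] with t ht
    simp only [Function.comp_apply]
    rw [hgc t ht, ← hfst _ (hgm (hcT t ht)), hinv.2 (hcT t ht)]

theorem IsFibrationDiffeo.trans {G : E → F} {M bM M' bM' M'' bM'' : Set E} {N N' N'' : Set F}
    {Φ Φ' : E → E} {ψ ψ' : F → F} (h : IsFibrationDiffeo G M bM N M' bM' N' Φ ψ)
    (h' : IsFibrationDiffeo G M' bM' N' M'' bM'' N'' Φ' ψ') :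
    IsFibrationDiffeo G M bM N M'' bM'' N'' (Φ' ∘ Φ) (ψ' ∘ ψ) := by
  refine ⟨h'.1.comp h.1, by rw [image_comp, h.2.1, h'.2.1], h'.2.2.1.comp h.2.2.1, ?_⟩
  intro x hx
  simp only [Function.comp_apply]
  rw [h'.2.2.2 _ (h.1.2.1 hx), h.2.2.2 x hx]

theorem IsFibrationDiffeo.interior {G : E → F} {M bM M' bM' : Set E} {N N' : Set F}
    {Φ : E → E} {ψ : F → F} (h : IsFibrationDiffeo G M bM N M' bM' N' Φ ψ) (hb : bM ⊆ M) :
    IsFibrationDiffeo G (M \ bM) ∅ N (M' \ bM') ∅ N' Φ ψ := by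
  refine ⟨h.1.restrict sdiff_subset ?_, image_empty _, h.2.2.1, fun x hx => h.2.2.2 x hx.1⟩
  rw [h.1.injOn.image_sdiff_subset hb, h.1.image_eq, h.2.1]

theorem IsFibrationDiffeo.exists_symm {G : E → F} {M bM M' bM' : Set E} {N N' : Set F}
    {Φ : E → E} {ψ ψ' : F → F} (h : IsFibrationDiffeo G M bM N M' bM' N' Φ ψ) (hb : bM ⊆ M)
    (hM : MapsTo G M N) (hψ' : IsDiffeoOn ψ' N' N) (hψ : LeftInvOn ψ' ψ N) :
    ∃ Φ', IsFibrationDiffeo G M' bM' N' M bM N Φ' ψ' := by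
  obtain ⟨⟨hs, hm, g, hgs, hgm, hinv⟩, himg, -, hcov⟩ := h
  refine ⟨g, ⟨hgs, hgm, Φ, hs, hm, hinv.symm⟩, ?_, hψ', ?_⟩
  · rw [← himg, ← image_comp]
    ext x
    constructor
    · rintro ⟨z, hz, rfl⟩
      rw [Function.comp_apply, hinv.1 (hb hz)]
      exact hz
    · intro hx
      exact ⟨x, hx, hinv.1 (hb hx)⟩
  · intro x hx
    have h1 := hcov (g x) (hgm hx)
    rw [hinv.2 hx] at h1
    rw [h1, hψ (hM (hgm hx))]

end Fibrations

/-! ### Ehresmann's theorem and the changes of level and of radius -/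

section Tubes

universe u

variable {E F : Type u} [NormedAddCommGroup E] [InnerProductSpace ℝ E] [FiniteDimensional ℝ E]
  [NormedAddCommGroup F] [InnerProductSpace ℝ F] [FiniteDimensional ℝ F]

theorem closedBall_inter_sdiff_sphere_inter {X : Type*} [PseudoMetricSpace X] (x : X) (ε : ℝ)
    (A : Set X) : (closedBall x ε ∩ A) \ (sphere x ε ∩ A) = ball x ε ∩ A := by
  ext y
  simp only [mem_sdiff, mem_inter_iff, mem_closedBall, mem_sphere, mem_ball]
  constructor
  · rintro ⟨⟨h1, h2⟩, h3⟩
    exact ⟨lt_of_le_of_ne h1 fun h => h3 ⟨h, h2⟩, h2⟩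
  · rintro ⟨h1, h2⟩
    exact ⟨⟨h1.le, h2⟩, fun h => h1.ne h.1⟩

/-- A fibrewise version of Ehresmann's theorem for a map on a closed ball which is submersive in
the interior and along the boundary sphere. -/
theorem isLocallyTrivialFibration_of_submersiveOver {G : E → F} {U : Set E} (hU : IsOpen U)
    (hG : ContDiffOn ℝ ∞ G U) {ε : ℝ} (hεU : closedBall 0 ε ⊆ U) {N : Set F} (hN : IsOpen N)
    (hS : SubmersiveOver G ε N) :
    IsLocallyTrivialFibration G (closedBall 0 ε ∩ G ⁻¹' N) (sphere 0 ε ∩ G ⁻¹' N) N := by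
  refine ⟨SmoothOnSet.of_contDiffOn hU hG (inter_subset_left.trans hεU), fun x hx => hx.2,
    fun y hy => ?_⟩
  obtain ⟨ρ, hρ, hρN⟩ := nhds_basis_closedBall.mem_iff.1 (hN.mem_nhds hy)
  obtain ⟨T, hT⟩ := exists_transport hU hG hεU isClosed_closedBall (hS.mono hρN) ρ
  have hnorm : ∀ z ∈ ball y ρ, ‖y - z‖ < ρ := fun z hz => by
    rw [← dist_eq_norm, dist_comm]; exact hz
  have hnorm' : ∀ z ∈ ball y ρ, ‖z - y‖ < ρ := fun z hz => by
    rw [← dist_eq_norm]; exact hz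
  have hseg : ∀ z ∈ ball y ρ, ∀ z' ∈ ball y ρ, ∀ s ∈ Icc (0 : ℝ) 1,
      z + s • (z' - z) ∈ interior (closedBall y ρ) := fun z hz z' hz' s hs =>
    ball_subset_interior_closedBall ((convex_ball y ρ).add_smul_sub_mem hz hz' hs)
  have hyb : y ∈ ball y ρ := mem_ball_self hρ
  -- The trivialization carries `x` over the segment from `G x` to the centre `y`; its inverse
  -- carries a point of the fibre over the segment from `y` to `z`. Both segments stay in the convex
  -- ball around `y`.
  set Φ : E → F × E := fun x => (G x, T x (y - G x)) with hΦ
  set g : F × E → E := fun q => T q.2 (q.1 - y) with hg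
  have hGΦ : ∀ x ∈ closedBall (0 : E) ε, G x ∈ ball y ρ → G (T x (y - G x)) = y := by
    intro x hx hxV
    rw [hT.lift x _ (hnorm _ hxV) hx (hseg _ hxV _ hyb)]
    abel
  have hGg : ∀ x ∈ closedBall (0 : E) ε, G x = y → ∀ z ∈ ball y ρ, G (T x (z - y)) = z := by
    intro x hx hxy z hz
    rw [hT.lift x _ (hnorm' _ hz) hx (by rw [hxy]; exact hseg _ hyb _ hz), hxy]
    abel
  -- Stating this for any transport-invariant `S` treats the closed ball, the open ball and the
  -- sphere at once.
  have hmaps : ∀ S ⊆ closedBall (0 : E) ε, (∀ x ∈ S, ∀ a, ‖a‖ < ρ → T x a ∈ S) →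
      MapsTo Φ (S ∩ G ⁻¹' N ∩ G ⁻¹' ball y ρ)
        ((N ∩ ball y ρ) ×ˢ (S ∩ G ⁻¹' N ∩ G ⁻¹' {y})) := by
    intro S hSb hST x hx
    have h1 := hGΦ x (hSb hx.1.1) hx.2
    refine ⟨⟨hx.1.2, hx.2⟩, ⟨hST x hx.1.1 _ (hnorm _ hx.2), ?_⟩, h1⟩
    rw [mem_preimage]
    change G (T x (y - G x)) ∈ N
    rw [h1]
    exact hy
  have hmaps' : ∀ S ⊆ closedBall (0 : E) ε, (∀ x ∈ S, ∀ a, ‖a‖ < ρ → T x a ∈ S) →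
      MapsTo g ((N ∩ ball y ρ) ×ˢ (S ∩ G ⁻¹' N ∩ G ⁻¹' {y}))
        (S ∩ G ⁻¹' N ∩ G ⁻¹' ball y ρ) := by
    rintro S hSb hST ⟨z, x⟩ ⟨hz, hx⟩
    have h1 := hGg x (hSb hx.1.1) hx.2 z hz.2
    refine ⟨⟨hST x hx.1.1 _ (hnorm' _ hz.2), ?_⟩, ?_⟩
    · change G (T x (z - y)) ∈ N
      rw [h1]; exact hz.1
    · change G (T x (z - y)) ∈ ball y ρ
      rw [h1]; exact hz.2
  have hinv : ∀ x ∈ closedBall (0 : E) ε, G x ∈ ball y ρ → g (Φ x) = x := by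
    intro x hx hxV
    simp only [hg, hΦ]
    rw [← neg_sub y (G x), hT.inv x _ (hnorm _ hxV)]
  have hinv' : ∀ x ∈ closedBall (0 : E) ε, G x = y → ∀ z ∈ ball y ρ, Φ (g (z, x)) = (z, x) := by
    intro x hx hxy z hz
    have h1 := hGg x hx hxy z hz
    simp only [hg, hΦ]
    rw [h1, ← neg_sub z y, hT.inv x _ (hnorm' _ hz)]
  have himage : ∀ S ⊆ closedBall (0 : E) ε, (∀ x ∈ S, ∀ a, ‖a‖ < ρ → T x a ∈ S) →
      Φ '' (S ∩ G ⁻¹' N ∩ G ⁻¹' ball y ρ) =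
        (N ∩ ball y ρ) ×ˢ (S ∩ G ⁻¹' N ∩ G ⁻¹' {y}) := by
    intro S hSb hST
    refine Subset.antisymm (hmaps S hSb hST).image_subset fun q hq => ⟨g q, hmaps' S hSb hST hq, ?_⟩
    exact hinv' q.2 (hSb hq.2.1.1) hq.2.2 q.1 hq.1.2
  have hcb : ∀ x ∈ closedBall (0 : E) ε, ∀ a, ‖a‖ < ρ → T x a ∈ closedBall (0 : E) ε :=
    fun x hx a ha => hT.closedBall ha hx
  have hVo : IsOpen (U ∩ G ⁻¹' ball y ρ) := hG.continuousOn.isOpen_inter_preimage hU isOpen_ball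
  refine ⟨ball y ρ, isOpen_ball, hyb, Φ, ⟨?_, hmaps _ Subset.rfl hcb, g, ?_,
    hmaps' _ Subset.rfl hcb, ?_, ?_⟩, fun x _ => rfl, ?_, ?_⟩
  · refine SmoothOnSet.of_contDiffOn hVo ?_ fun x hx => ⟨hεU hx.1.1, hx.2⟩
    have hG' : ContDiffOn ℝ ∞ G (U ∩ G ⁻¹' ball y ρ) := hG.mono inter_subset_left
    exact hG'.prodMk (hT.smooth.comp (contDiffOn_id.prodMk (contDiffOn_const.sub hG'))
      fun x hx => hnorm _ hx.2)
  · refine SmoothOnSet.of_contDiffOn (V := Prod.fst ⁻¹' ball y ρ)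
      (isOpen_ball.preimage continuous_fst) ?_ fun q hq => hq.1.2
    exact hT.smooth.comp
      (contDiff_snd.prodMk (contDiff_fst.sub contDiff_const)).contDiffOn fun q hq => hnorm' _ hq
  · intro x hx
    exact hinv x hx.1.1 hx.2
  · rintro ⟨z, x⟩ ⟨hz, hx⟩
    exact hinv' x hx.1.1 hx.2 z hz.2
  · rw [closedBall_inter_sdiff_sphere_inter]
    exact himage _ ball_subset_closedBall fun x hx a ha => hT.ball x a ha hx
  · exact himage _ sphere_subset_closedBall fun x hx a ha => hT.sphere x a ha hx

theorem isDiffeoOn_smul_sphere {c δ δ' : ℝ} (hc : 0 < c) (h : δ' = c * δ) :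
    IsDiffeoOn (fun y : F => c • y) (sphere 0 δ) (sphere 0 δ') := by
  have hs : ∀ c : ℝ, ContDiff ℝ ∞ fun y : F => c • y := fun c => contDiff_id.const_smul c
  refine ⟨SmoothOnSet.of_contDiffOn isOpen_univ (hs c).contDiffOn (subset_univ _), ?_,
    fun y => c⁻¹ • y, SmoothOnSet.of_contDiffOn isOpen_univ (hs _).contDiffOn (subset_univ _), ?_,
    fun y _ => inv_smul_smul₀ hc.ne' y, fun y _ => smul_inv_smul₀ hc.ne' y⟩
  · intro y hy
    rw [mem_sphere_zero_iff_norm] at hy ⊢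
    rw [norm_smul, Real.norm_of_nonneg hc.le, hy, h]
  · intro y hy
    rw [mem_sphere_zero_iff_norm] at hy ⊢
    rw [norm_smul, norm_inv, Real.norm_of_nonneg hc.le, hy, h, inv_mul_cancel_left₀ hc.ne']

/-- The fibrations over the spheres of radius less than `δ₀` are diffeomorphic. -/
theorem exists_rescale {G : E → F} {U : Set E} (hU : IsOpen U)
    (hG : ContDiffOn ℝ ∞ G U) {ε : ℝ} (hεU : closedBall 0 ε ⊆ U) {δ₀ : ℝ}
    (hS : SubmersiveOver G ε (ball 0 δ₀ \ {0})) {δ δ' : ℝ} (hδ : 0 < δ) (hδ₀ : δ < δ₀)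
    (hδ' : 0 < δ') (hδ'₀ : δ' < δ₀) :
    ∃ Φ, IsFibrationDiffeo G
      (closedBall 0 ε ∩ G ⁻¹' sphere 0 δ) (sphere 0 ε ∩ G ⁻¹' sphere 0 δ)
      (sphere 0 δ)
      (closedBall 0 ε ∩ G ⁻¹' sphere 0 δ') (sphere 0 ε ∩ G ⁻¹' sphere 0 δ')
      (sphere 0 δ') Φ (fun y => (δ' / δ) • y) := by
  obtain ⟨m, hm, hmδ⟩ := exists_between (lt_min hδ hδ')
  obtain ⟨M, hMδ, hM⟩ := exists_between (max_lt hδ₀ hδ'₀)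
  rw [lt_min_iff] at hmδ
  rw [max_lt_iff] at hMδ
  -- A closed annulus inside the punctured ball whose interior contains both spheres, hence also the
  -- radial segments joining them.
  set C : Set F := {y | m ≤ ‖y‖ ∧ ‖y‖ ≤ M} with hC
  have hCc : IsClosed C :=
    (isClosed_le continuous_const continuous_norm).inter
      (isClosed_le continuous_norm continuous_const)
  have hCs : C ⊆ ball 0 δ₀ \ {0} := by
    rintro y ⟨h1, h2⟩
    refine ⟨mem_ball_zero_iff.2 (h2.trans_lt hM), ?_⟩
    rintro rfl
    rw [norm_zero] at h1
    linarith
  have hCi : ∀ y : F, m < ‖y‖ → ‖y‖ < M → y ∈ interior C := by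
    intro y h1 h2
    refine mem_interior.2 ⟨{y | m < ‖y‖} ∩ {y | ‖y‖ < M}, fun z hz => ⟨hz.1.le, hz.2.le⟩,
      (isOpen_lt continuous_const continuous_norm).inter
        (isOpen_lt continuous_norm continuous_const), h1, h2⟩
  obtain ⟨T, hT⟩ := exists_transport hU hG hεU hCc (hS.mono hCs) (|δ' - δ| + 1)
  -- The radial displacement has norm `|d' - d|`, within the range of `T`. The radii `d`, `d'` are
  -- kept general because the map and its inverse use them in the two orders.
  have hsmall : ∀ d d' : ℝ, 0 < d → |d' - d| = |δ' - δ| → ∀ y : F, ‖y‖ = d →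
      ‖(d' / d - 1) • y‖ < |δ' - δ| + 1 := by
    intro d d' hd hdd y hy
    have : (d' / d - 1) * d = d' - d := by field_simp
    rw [norm_smul, hy, Real.norm_eq_abs, ← abs_of_pos hd, ← abs_mul, abs_of_pos hd, this, hdd]
    linarith
  have hlift : ∀ d d' : ℝ, m < d → d < M → m < d' → d' < M → |d' - d| = |δ' - δ| →
      ∀ x ∈ closedBall (0 : E) ε, ‖G x‖ = d →
      G (T x ((d' / d - 1) • G x)) = (d' / d) • G x := by
    intro d d' h1 h2 h3 h4 hdd x hx hxd
    have hd : 0 < d := hm.trans h1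
    rw [hT.lift x _ (hsmall d d' hd hdd _ hxd) hx, sub_smul, one_smul, add_sub_cancel]
    intro s hs
    have e : G x + s • (d' / d - 1) • G x = (((1 - s) * d + s * d') / d) • G x := by
      rw [smul_smul]
      nth_rw 1 [← one_smul ℝ (G x)]
      rw [← add_smul]
      congr 1
      field_simp
      ring
    have hconv : (1 - s) * d + s * d' ∈ Ioo m M := by
      have := (convex_Ioo m M) ⟨h1, h2⟩ ⟨h3, h4⟩ (sub_nonneg.2 hs.2) hs.1 (by ring)
      simpa using this
    have hn : ‖G x + s • (d' / d - 1) • G x‖ = (1 - s) * d + s * d' := by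
      rw [e, norm_smul, hxd, Real.norm_of_nonneg (div_nonneg (hm.trans hconv.1).le hd.le),
        div_mul_cancel₀ _ hd.ne']
    exact hCi _ (hn ▸ hconv.1) (hn ▸ hconv.2)
  have hsphere : ∀ d d' : ℝ, m < d → d < M → m < d' → d' < M → |d' - d| = |δ' - δ| →
      ∀ x ∈ closedBall (0 : E) ε, ‖G x‖ = d → ‖G (T x ((d' / d - 1) • G x))‖ = d' := by
    intro d d' h1 h2 h3 h4 hdd x hx hxd
    have hd : 0 < d := hm.trans h1
    rw [hlift d d' h1 h2 h3 h4 hdd x hx hxd, norm_smul, hxd,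
      Real.norm_of_nonneg (div_nonneg (hm.trans h3).le hd.le), div_mul_cancel₀ _ hd.ne']
  have hinv : ∀ d d' : ℝ, m < d → d < M → m < d' → d' < M → |d' - d| = |δ' - δ| →
      ∀ x ∈ closedBall (0 : E) ε, ‖G x‖ = d →
      T (T x ((d' / d - 1) • G x)) ((d / d' - 1) • G (T x ((d' / d - 1) • G x))) = x := by
    intro d d' h1 h2 h3 h4 hdd x hx hxd
    have hd : 0 < d := hm.trans h1
    have hd' : 0 < d' := hm.trans h3
    have e : (d / d' - 1) • G (T x ((d' / d - 1) • G x)) = -((d' / d - 1) • G x) := by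
      rw [hlift d d' h1 h2 h3 h4 hdd x hx hxd, smul_smul, ← neg_smul]
      congr 1
      field_simp
      ring
    rw [e, hT.inv x _ (hsmall d d' hd hdd _ hxd)]
  have hsm : ∀ d d' : ℝ, 0 < d → |d' - d| = |δ' - δ| →
      SmoothOnSet (fun x => T x ((d' / d - 1) • G x)) (closedBall 0 ε ∩ G ⁻¹' sphere 0 d) := by
    intro d d' hd hdd
    have hsG : ContDiffOn ℝ ∞ (fun x => (d' / d - 1) • G x) U := hG.const_smul _
    refine SmoothOnSet.of_contDiffOn
      (V := U ∩ (fun x => (d' / d - 1) • G x) ⁻¹' ball 0 (|δ' - δ| + 1))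
      (hsG.continuousOn.isOpen_inter_preimage hU isOpen_ball) ?_ ?_
    · exact hT.smooth.comp (contDiffOn_id.prodMk (hsG.mono inter_subset_left))
        fun x hx => mem_ball_zero_iff.1 hx.2
    · exact fun x hx => ⟨hεU hx.1, mem_ball_zero_iff.2
        (hsmall d d' hd hdd _ (mem_sphere_zero_iff_norm.1 hx.2))⟩
  have hdd' : |δ - δ'| = |δ' - δ| := abs_sub_comm _ _
  have hmaps : ∀ d d' : ℝ, m < d → d < M → m < d' → d' < M → |d' - d| = |δ' - δ| →
      ∀ S ⊆ closedBall (0 : E) ε, (∀ x ∈ S, ∀ a, ‖a‖ < |δ' - δ| + 1 → T x a ∈ S) →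
      MapsTo (fun x => T x ((d' / d - 1) • G x)) (S ∩ G ⁻¹' sphere 0 d)
        (S ∩ G ⁻¹' sphere 0 d') := by
    intro d d' h1 h2 h3 h4 hdd S hSb hST x hx
    have hxd := mem_sphere_zero_iff_norm.1 hx.2
    exact ⟨hST x hx.1 _ (hsmall d d' (hm.trans h1) hdd _ hxd),
      mem_sphere_zero_iff_norm.2 (hsphere d d' h1 h2 h3 h4 hdd x (hSb hx.1) hxd)⟩
  have hcb : ∀ x ∈ closedBall (0 : E) ε, ∀ a, ‖a‖ < |δ' - δ| + 1 → T x a ∈ closedBall (0 : E) ε :=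
    fun x hx a ha => hT.closedBall ha hx
  have hsp : ∀ x ∈ sphere (0 : E) ε, ∀ a, ‖a‖ < |δ' - δ| + 1 →
      T x a ∈ sphere (0 : E) ε := fun x hx a ha => hT.sphere x a ha hx
  refine ⟨fun x => T x ((δ' / δ - 1) • G x), ⟨hsm δ δ' hδ rfl,
    hmaps δ δ' hmδ.1 hMδ.1 hmδ.2 hMδ.2 rfl _ Subset.rfl hcb,
    fun x => T x ((δ / δ' - 1) • G x), hsm δ' δ hδ' hdd',
    hmaps δ' δ hmδ.2 hMδ.2 hmδ.1 hMδ.1 hdd' _ Subset.rfl hcb, ?_, ?_⟩, ?_,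
    isDiffeoOn_smul_sphere (div_pos hδ' hδ) (by field_simp), ?_⟩
  · exact fun x hx => hinv δ δ' hmδ.1 hMδ.1 hmδ.2 hMδ.2 rfl x hx.1 (mem_sphere_zero_iff_norm.1 hx.2)
  · exact fun x hx => hinv δ' δ hmδ.2 hMδ.2 hmδ.1 hMδ.1 hdd' x hx.1
      (mem_sphere_zero_iff_norm.1 hx.2)
  · refine Subset.antisymm (hmaps δ δ' hmδ.1 hMδ.1 hmδ.2 hMδ.2 rfl _
      sphere_subset_closedBall hsp).image_subset fun x hx => ?_
    exact ⟨_, hmaps δ' δ hmδ.2 hMδ.2 hmδ.1 hMδ.1 hdd' _ sphere_subset_closedBall hsp hx,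
      hinv δ' δ hmδ.2 hMδ.2 hmδ.1 hMδ.1 hdd' x (sphere_subset_closedBall hx.1)
        (mem_sphere_zero_iff_norm.1 hx.2)⟩
  · exact fun x hx => hlift δ δ' hmδ.1 hMδ.1 hmδ.2 hMδ.2 rfl x hx.1
      (mem_sphere_zero_iff_norm.1 hx.2)

/-- A diffeomorphism of the line which is the identity below `c` and moves `b` up to `b'`. -/
theorem exists_shift {c b b' : ℝ} (hcb : c < b) (hbb' : b < b') :
    ∃ β β' : ℝ → ℝ, ContDiff ℝ ∞ β ∧ ContDiff ℝ ∞ β' ∧ (∀ s, β' (β s) = s) ∧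
      (∀ s, β (β' s) = s) ∧ StrictMono β ∧ (∀ s ≤ c, β s = s) ∧ β b = b' ∧ (∀ s, s ≤ β s) ∧
      ∀ s, β s ≤ s + (b' - b) := by
  set κ := b' - b with hκ
  have hκ0 : 0 < κ := sub_pos.2 hbb'
  have hcb0 : 0 < b - c := sub_pos.2 hcb
  -- A smooth step rising from `0` at `c` to `1` at `b`; `β` adds `κ` times it to the identity.
  set τ : ℝ → ℝ := fun s => Real.smoothTransition ((s - c) / (b - c)) with hτ
  have hτs : ContDiff ℝ ∞ τ :=
    Real.smoothTransition.contDiff.comp ((contDiff_id.sub contDiff_const).div_const _)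
  have hτm : Monotone τ := by
    intro s t hst
    exact Real.smoothTransition.monotone (by gcongr)
  set β : ℝ → ℝ := fun s => s + κ * τ s with hβ
  have hβs : ContDiff ℝ ∞ β := contDiff_id.add (contDiff_const.mul hτs)
  have hβm : StrictMono β := strictMono_id.add_monotone (hτm.const_mul hκ0.le)
  have hle : ∀ s, s ≤ β s := fun s => by
    have := Real.smoothTransition.nonneg ((s - c) / (b - c))
    have := mul_nonneg hκ0.le this
    simp only [hβ, hτ]
    linarith
  have hle' : ∀ s, β s ≤ s + κ := fun s => by
    have := Real.smoothTransition.le_one ((s - c) / (b - c))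
    have := mul_le_mul_of_nonneg_left this hκ0.le
    simp only [hβ, hτ]
    linarith
  have hsurj : Function.Surjective β := hβs.continuous.surjective
    (Filter.tendsto_atTop_mono hle Filter.tendsto_id)
    (Filter.tendsto_atBot_mono hle' (Filter.tendsto_atBot_add_const_right _ _ Filter.tendsto_id))
  set e : ℝ ≃ₜ ℝ := (hβm.orderIsoOfSurjective β hsurj).toHomeomorph with he
  have heβ : ⇑e = β := rfl
  have hτd : ∀ s, HasDerivAt τ (deriv τ s) s := fun s =>
    (hτs.differentiable (by simp) s).hasDerivAt
  have hes : ContDiff ℝ ∞ e.symm := by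
    -- The inverse is smooth because `β` has derivative `1 + κ τ' ≥ 1`.
    refine e.contDiff_symm_deriv (f' := fun s => 1 + κ * deriv τ s) (fun s => ?_) (fun s => ?_) hβs
    · have := mul_nonneg hκ0.le (hτm.deriv_nonneg (x := s))
      positivity
    · exact (hasDerivAt_id s).add ((hτd s).const_mul κ)
  refine ⟨β, e.symm, hβs, hes, fun s => e.symm_apply_apply s, fun s => e.apply_symm_apply s, hβm,
    fun s hs => ?_, ?_, hle, hle'⟩
  · have : (s - c) / (b - c) ≤ 0 := div_nonpos_of_nonpos_of_nonneg (sub_nonpos.2 hs) hcb0.le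
    simp [hβ, hτ, Real.smoothTransition.zero_of_nonpos this]
  · simp [hβ, hτ, div_self hcb0.ne', hκ]

/-- If the spheres between the radii `ε` and `ε'` are transverse to the fibres of `G` over the
sphere of radius `δ`, then the fibrations over that sphere cut out by the balls of radius `ε` and
`ε'` are diffeomorphic. -/
theorem exists_change_radius {G : E → F} {U : Set E} (hU : IsOpen U) (hG : ContDiffOn ℝ ∞ G U)
    {ε₀ ε ε' δ : ℝ} (hεU : closedBall 0 ε₀ ⊆ U) (hε : 0 < ε) (hεε' : ε < ε') (hε' : ε' < ε₀)
    (hδ : 0 < δ) (hS : ∀ x ∈ closedBall (0 : E) ε₀, ε / 2 ≤ ‖x‖ → 0 < ‖G x‖ → ‖G x‖ ≤ 2 * δ →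
      Function.Surjective ((fderiv ℝ G x).prod (innerSL ℝ x))) :
    ∃ Φ, IsFibrationDiffeo G
      (closedBall 0 ε ∩ G ⁻¹' sphere 0 δ) (sphere 0 ε ∩ G ⁻¹' sphere 0 δ) (sphere 0 δ)
      (closedBall 0 ε' ∩ G ⁻¹' sphere 0 δ) (sphere 0 ε' ∩ G ⁻¹' sphere 0 δ) (sphere 0 δ)
      Φ id := by
  have hε0' : 0 < ε' := hε.trans hεε'
  have hsq : ε ^ 2 < ε' ^ 2 := by gcongr
  have hsq' : ε' ^ 2 < ε₀ ^ 2 := by gcongr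
  obtain ⟨e, he, he₀⟩ := exists_between hsq'
  set c : ℝ := ε ^ 2 / 2 with hc
  have hc0 : 0 < c := by positivity
  obtain ⟨β, β', hβs, hβs', hββ, hββ', hβm, hβc, hβb, hle, hle'⟩ :=
    exists_shift (c := c) (b := ε ^ 2) (b' := ε' ^ 2) (by rw [hc]; linarith [pow_pos hε 2]) hsq
  set κ := ε' ^ 2 - ε ^ 2 with hκ
  set G₂ : E → F × ℝ := fun x => (G x, ‖x‖ ^ 2) with hG₂
  have hG₂s : ContDiffOn ℝ ∞ G₂ U := hG.prodMk (contDiff_norm_sq ℝ).contDiffOn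
  -- The bound `e < ε₀²` keeps `C` away from the sphere of radius `ε₀`, so the boundary condition in
  -- `SubmersiveOver G₂ ε₀ C` is vacuous. The bound `ε² / 4` lies below `c = ε² / 2`, where the
  -- motion starts, and matches `ε / 2 ≤ ‖x‖` in `hS`.
  set C : Set (F × ℝ) := {q | (δ / 2 ≤ ‖q.1‖ ∧ ‖q.1‖ ≤ 2 * δ) ∧ ε ^ 2 / 4 ≤ q.2 ∧ q.2 ≤ e} with hC
  have hCc : IsClosed C := by
    exact ((isClosed_le continuous_const continuous_fst.norm).inter
      (isClosed_le continuous_fst.norm continuous_const)).inter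
      ((isClosed_le continuous_const continuous_snd).inter
        (isClosed_le continuous_snd continuous_const))
  have hCi : ∀ q : F × ℝ, ‖q.1‖ = δ → c ≤ q.2 → q.2 ≤ ε' ^ 2 → q ∈ interior C := by
    intro q h1 h2 h3
    refine mem_interior.2 ⟨{q | (δ / 2 < ‖q.1‖ ∧ ‖q.1‖ < 2 * δ) ∧ ε ^ 2 / 4 < q.2 ∧ q.2 < e},
      fun z hz => ⟨⟨hz.1.1.le, hz.1.2.le⟩, hz.2.1.le, hz.2.2.le⟩, ?_,
      ⟨by rw [h1]; linarith, by rw [h1]; linarith⟩, ?_, h3.trans_lt he⟩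
    · exact ((isOpen_lt continuous_const continuous_fst.norm).inter
        (isOpen_lt continuous_fst.norm continuous_const)).inter
        ((isOpen_lt continuous_const continuous_snd).inter
          (isOpen_lt continuous_snd continuous_const))
    · rw [hc] at h2
      linarith [pow_pos hε 2]
  have hsub : SubmersiveOver G₂ ε₀ C := by
    refine ⟨fun x hx hxC => ?_, fun x hx hxC => ?_⟩
    · have hx2 : ε / 2 ≤ ‖x‖ := by
        have h := hxC.2.1
        simp only [hG₂] at h
        refine le_of_sq_le_sq ?_ (norm_nonneg x)
        calc (ε / 2) ^ 2 = ε ^ 2 / 4 := by ring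
          _ ≤ _ := h
      have hsurj := hS x hx hx2 ((half_pos hδ).trans_le hxC.1.1) hxC.1.2
      have hd : HasFDerivAt G₂ ((fderiv ℝ G x).prod (2 • innerSL ℝ x)) x :=
        ((hG.contDiffAt (hU.mem_nhds (hεU hx))).differentiableAt (by simp)).hasFDerivAt.prodMk
          (hasStrictFDerivAt_norm_sq x).hasFDerivAt
      rw [hd.fderiv]
      rintro ⟨w, s⟩
      obtain ⟨v, hv⟩ := hsurj (w, s / 2)
      refine ⟨v, ?_⟩
      have h1 : fderiv ℝ G x v = w := congrArg Prod.fst hv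
      have h2 : inner ℝ x v = s / 2 := congrArg Prod.snd hv
      ext
      · simp [h1]
      · simp [h2, mul_div_cancel₀]
    · have h := hxC.2.2
      simp only [hG₂] at h
      rw [mem_sphere_zero_iff_norm.1 hx] at h
      linarith
  obtain ⟨T, hT⟩ := exists_transport hU hG₂s hεU hCc hsub (κ + 1)
  have hnorm : ∀ r : ℝ, |r| ≤ κ → ‖((0 : F), r)‖ < κ + 1 := by
    intro r hr
    rw [Prod.norm_def]
    simp only [norm_zero, Real.norm_eq_abs]
    rw [max_eq_right (abs_nonneg r)]
    linarith
  -- Transport by `(0, s' - ‖x‖²)` moves `x` inside its fibre to the level `‖·‖² = s'`. Near the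
  -- origin transversality may fail, but there the displacement is zero and `T x 0 = x`.
  have hshift : ∀ x : E, ‖x‖ ≤ ε' → ‖G x‖ = δ → ∀ s' : ℝ,
      (s' = ‖x‖ ^ 2 ∨ (c ≤ ‖x‖ ^ 2 ∧ c ≤ s')) → s' ≤ ε' ^ 2 → |s' - ‖x‖ ^ 2| ≤ κ →
      G (T x (0, s' - ‖x‖ ^ 2)) = G x ∧ ‖T x (0, s' - ‖x‖ ^ 2)‖ ^ 2 = s' := by
    intro x hx hxδ s' hs hs' hsκ
    rcases hs with rfl | ⟨h1, h2⟩
    · rw [sub_self]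
      have : T x (0, 0) = x := hT.zero x
      rw [this]
      exact ⟨rfl, rfl⟩
    · have hx2 : ‖x‖ ^ 2 ≤ ε' ^ 2 := by gcongr
      have := hT.lift x (0, s' - ‖x‖ ^ 2) (hnorm _ hsκ)
        (mem_closedBall_zero_iff.2 (hx.trans hε'.le)) (by
          intro t ht
          have hmem : (1 - t) * ‖x‖ ^ 2 + t * s' ∈ Icc c (ε' ^ 2) := by
            have := (convex_Icc c (ε' ^ 2)) ⟨h1, hx2⟩ ⟨h2, hs'⟩ (sub_nonneg.2 ht.2) ht.1 (by ring)
            simpa using this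
          have e2 : ‖x‖ ^ 2 + t * (s' - ‖x‖ ^ 2) = (1 - t) * ‖x‖ ^ 2 + t * s' := by ring
          refine hCi _ ?_ ?_ ?_
          · simpa [hG₂] using hxδ
          · simp only [hG₂, Prod.smul_mk, Prod.mk_add_mk, smul_eq_mul, e2]
            exact hmem.1
          · simp only [hG₂, Prod.smul_mk, Prod.mk_add_mk, smul_eq_mul, e2]
            exact hmem.2)
      simp only [hG₂, Prod.mk_add_mk, add_zero, add_sub_cancel, Prod.mk.injEq] at this
      exact this
  have hκβ : ∀ s, |β s - s| ≤ κ := fun s => by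
    rw [abs_of_nonneg (sub_nonneg.2 (hle s))]
    linarith [hle' s]
  have hκβ' : ∀ s, |β' s - s| ≤ κ := fun s => by
    have := hκβ (β' s)
    rwa [hββ', abs_sub_comm] at this
  have hβm' : ∀ {s t}, s ≤ t → β' s ≤ β' t := fun {s t} hst => by
    rwa [← hβm.le_iff_le, hββ', hββ']
  have hβc' : ∀ s ≤ c, β' s = s := fun s hs => by
    nth_rw 1 [← hβc s hs]
    exact hββ s
  have hβb' : β' (ε' ^ 2) = ε ^ 2 := by rw [← hβb, hββ]
  have hf : ∀ x : E, ‖x‖ ≤ ε → ‖G x‖ = δ →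
      G (T x (0, β (‖x‖ ^ 2) - ‖x‖ ^ 2)) = G x ∧
        ‖T x (0, β (‖x‖ ^ 2) - ‖x‖ ^ 2)‖ ^ 2 = β (‖x‖ ^ 2) := by
    intro x hx hxδ
    refine hshift x (hx.trans hεε'.le) hxδ _ ?_ ?_ (hκβ _)
    · rcases le_total (‖x‖ ^ 2) c with h | h
      · exact Or.inl (hβc _ h)
      · exact Or.inr ⟨h, h.trans (hle _)⟩
    · rw [← hβb]
      exact hβm.monotone (by gcongr)
  have hg : ∀ x : E, ‖x‖ ≤ ε' → ‖G x‖ = δ →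
      G (T x (0, β' (‖x‖ ^ 2) - ‖x‖ ^ 2)) = G x ∧
        ‖T x (0, β' (‖x‖ ^ 2) - ‖x‖ ^ 2)‖ ^ 2 = β' (‖x‖ ^ 2) := by
    intro x hx hxδ
    refine hshift x hx hxδ _ ?_ ?_ (hκβ' _)
    · rcases le_total (‖x‖ ^ 2) c with h | h
      · exact Or.inl (hβc' _ h)
      · exact Or.inr ⟨h, by rw [← hβc' c le_rfl]; exact hβm' h⟩
    · calc β' (‖x‖ ^ 2) ≤ β' (ε' ^ 2) := hβm' (by gcongr)
        _ = ε ^ 2 := hβb'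
        _ ≤ ε' ^ 2 := hsq.le
  have hgf : ∀ x : E, ‖x‖ ≤ ε → ‖G x‖ = δ →
      T (T x (0, β (‖x‖ ^ 2) - ‖x‖ ^ 2))
        (0, β' (‖T x (0, β (‖x‖ ^ 2) - ‖x‖ ^ 2)‖ ^ 2) -
          ‖T x (0, β (‖x‖ ^ 2) - ‖x‖ ^ 2)‖ ^ 2) = x := by
    intro x hx hxδ
    rw [(hf x hx hxδ).2, hββ]
    have := hT.inv x (0, β (‖x‖ ^ 2) - ‖x‖ ^ 2) (hnorm _ (hκβ _))
    rwa [Prod.neg_mk, neg_zero, neg_sub] at this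
  have hfg : ∀ x : E, ‖x‖ ≤ ε' → ‖G x‖ = δ →
      T (T x (0, β' (‖x‖ ^ 2) - ‖x‖ ^ 2))
        (0, β (‖T x (0, β' (‖x‖ ^ 2) - ‖x‖ ^ 2)‖ ^ 2) -
          ‖T x (0, β' (‖x‖ ^ 2) - ‖x‖ ^ 2)‖ ^ 2) = x := by
    intro x hx hxδ
    rw [(hg x hx hxδ).2, hββ']
    have := hT.inv x (0, β' (‖x‖ ^ 2) - ‖x‖ ^ 2) (hnorm _ (hκβ' _))
    rwa [Prod.neg_mk, neg_zero, neg_sub] at this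
  have hsm : ∀ θ : ℝ → ℝ, ContDiff ℝ ∞ θ → (∀ s, |θ s - s| ≤ κ) → ∀ S : Set E,
      SmoothOnSet (fun x => T x (0, θ (‖x‖ ^ 2) - ‖x‖ ^ 2)) S := by
    intro θ hθ hθκ S
    refine SmoothOnSet.of_contDiffOn isOpen_univ ?_ (subset_univ S)
    have hn : ContDiff ℝ ∞ fun x : E => ‖x‖ ^ 2 := contDiff_norm_sq ℝ
    exact hT.smooth.comp (contDiff_id.prodMk
      (contDiff_const.prodMk ((hθ.comp hn).sub hn))).contDiffOn fun x _ => hnorm _ (hθκ _)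
  refine ⟨fun x => T x (0, β (‖x‖ ^ 2) - ‖x‖ ^ 2), ⟨hsm β hβs hκβ _, ?_,
    fun x => T x (0, β' (‖x‖ ^ 2) - ‖x‖ ^ 2), hsm β' hβs' hκβ' _, ?_, ?_, ?_⟩, ?_, ?_, ?_⟩
  · intro x hx
    have hxε := mem_closedBall_zero_iff.1 hx.1
    have hxδ := mem_sphere_zero_iff_norm.1 hx.2
    obtain ⟨h1, h2⟩ := hf x hxε hxδ
    refine ⟨mem_closedBall_zero_iff.2 (le_of_sq_le_sq ?_ hε0'.le), ?_⟩
    · rw [h2, ← hβb]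
      exact hβm.monotone (by gcongr)
    · rw [mem_preimage, h1]
      exact hx.2
  · intro x hx
    have hxε := mem_closedBall_zero_iff.1 hx.1
    have hxδ := mem_sphere_zero_iff_norm.1 hx.2
    obtain ⟨h1, h2⟩ := hg x hxε hxδ
    refine ⟨mem_closedBall_zero_iff.2 (le_of_sq_le_sq ?_ hε.le), ?_⟩
    · rw [h2, ← hβb']
      exact hβm' (by gcongr)
    · rw [mem_preimage, h1]
      exact hx.2
  · exact fun x hx => hgf x (mem_closedBall_zero_iff.1 hx.1) (mem_sphere_zero_iff_norm.1 hx.2)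
  · exact fun x hx => hfg x (mem_closedBall_zero_iff.1 hx.1) (mem_sphere_zero_iff_norm.1 hx.2)
  · refine Subset.antisymm ?_ fun x hx => ?_
    · rintro _ ⟨x, hx, rfl⟩
      have hxε := mem_sphere_zero_iff_norm.1 hx.1
      obtain ⟨h1, h2⟩ := hf x hxε.le (mem_sphere_zero_iff_norm.1 hx.2)
      refine ⟨mem_sphere_zero_iff_norm.2 ?_, ?_⟩
      · rw [← sq_eq_sq₀ (norm_nonneg _) hε0'.le]
        exact h2.trans (by rw [hxε, hβb])
      · rw [mem_preimage, h1]
        exact hx.2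
    · have hxε := mem_sphere_zero_iff_norm.1 hx.1
      have hxδ := mem_sphere_zero_iff_norm.1 hx.2
      obtain ⟨h1, h2⟩ := hg x hxε.le hxδ
      refine ⟨_, ⟨mem_sphere_zero_iff_norm.2 ?_, ?_⟩, hfg x hxε.le hxδ⟩
      · rw [← sq_eq_sq₀ (norm_nonneg _) hε.le]
        exact h2.trans (by rw [hxε, hβb'])
      · rw [mem_preimage, h1]
        exact hx.2
  · have := isDiffeoOn_smul_sphere (F := F) (c := 1) (δ := δ) one_pos (one_mul δ).symm
    simp only [one_smul] at this
    exact this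
  · exact fun x hx => (hf x (mem_closedBall_zero_iff.1 hx.1) (mem_sphere_zero_iff_norm.1 hx.2)).1

end Tubes

/-! ### Stratified submersions compared with surjectivity of differentials -/

section StratifiedSubmersions

universe u

variable {E F : Type u} [NormedAddCommGroup E] [InnerProductSpace ℝ E] [FiniteDimensional ℝ E]
  [NormedAddCommGroup F] [InnerProductSpace ℝ F] [FiniteDimensional ℝ F]

/-- A continuous map from a compact space to a Hausdorff space is proper, and properness survives
restriction to the preimage of `N`. -/
theorem isProperOn_of_isCompact {X Y : Type*} [NormedAddCommGroup X] [NormedAddCommGroup Y]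
    {G : X → Y} {K : Set X} (hK : IsCompact K) (hG : ContinuousOn G K) (N : Set Y) :
    IsProperOn G (K ∩ G ⁻¹' N) N := by
  have : CompactSpace K := isCompact_iff_compactSpace.1 hK
  have hc : Continuous (K.domRestrict G) := continuousOn_iff_continuous_domRestrict.1 hG
  have h1 : IsProperMap (N.restrictPreimage (K.domRestrict G)) :=
    hc.isProperMap.restrictPreimage N
  let e : ↥(K ∩ G ⁻¹' N) ≃ₜ ↥((K.domRestrict G) ⁻¹' N) :=
    { toFun := fun x => ⟨⟨x.1, x.2.1⟩, x.2.2⟩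
      invFun := fun x => ⟨x.1.1, x.1.2, x.2⟩
      left_inv := fun _ => rfl
      right_inv := fun _ => rfl
      continuous_toFun := by fun_prop
      continuous_invFun := by fun_prop }
  exact ⟨fun x hx => hx.2, h1.comp e.isProperMap⟩

/-- The zero set in an open set of a map with surjective differential is a submanifold. -/
theorem isSubmanifoldWithBoundary_zeroSet {c : ℕ} {h : F → Fin c → ℝ} (hh : ContDiff ℝ ∞ h)
    {O N : Set F} (hO : IsOpen O) (hN : N = {y ∈ O | h y = 0})
    (hsurj : ∀ y ∈ N, Function.Surjective (fderiv ℝ h y)) : IsSubmanifoldWithBoundary N ∅ c := by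
  refine ⟨empty_subset _, fun y hy => ?_, fun y hy => absurd hy (notMem_empty y)⟩
  have hyN : y ∈ N := hy.1
  have hyO : y ∈ {y ∈ O | h y = 0} := hN ▸ hyN
  refine ⟨O, hO, hyO.1, empty_inter _, h, hh.contDiffOn, hsurj y hyN, ?_⟩
  rw [hN]
  exact inter_eq_left.2 fun z hz => hz.1

/-- If `h` cuts out `N`, then `h ∘ G` cuts out the preimage, with surjective differential by the
chain rule. At the boundary one adds `‖x‖² - ε²`; the sphere condition of `SubmersiveOver` gives
joint surjectivity. -/
theorem isSubmanifoldWithBoundary_preimage {G : E → F} {U : Set E} (hU : IsOpen U)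
    (hG : ContDiffOn ℝ ∞ G U) {ε : ℝ} (hε : 0 < ε) (hεU : closedBall 0 ε ⊆ U) {c : ℕ}
    {h : F → Fin c → ℝ} (hh : ContDiff ℝ ∞ h) {O N : Set F} (hO : IsOpen O)
    (hN : N = {y ∈ O | h y = 0}) (hsurj : ∀ y ∈ N, Function.Surjective (fderiv ℝ h y))
    (hS : SubmersiveOver G ε N) :
    IsSubmanifoldWithBoundary (closedBall 0 ε ∩ G ⁻¹' N) (sphere 0 ε ∩ G ⁻¹' N) c := by
  have hmem : ∀ y, y ∈ N ↔ y ∈ O ∧ h y = 0 := fun y => by rw [hN]; rfl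
  have hd : ∀ x ∈ U, fderiv ℝ (fun x => h (G x)) x = (fderiv ℝ h (G x)).comp (fderiv ℝ G x) :=
    fun x hx => fderiv_comp x (hh.differentiable (by simp) _)
      ((hG.contDiffAt (hU.mem_nhds hx)).differentiableAt (by simp))
  refine ⟨inter_subset_inter_left _ sphere_subset_closedBall, ?_, ?_⟩
  · intro x hx
    rw [closedBall_inter_sdiff_sphere_inter] at hx
    have hbU : ball (0 : E) ε ⊆ U := ball_subset_closedBall.trans hεU
    refine ⟨ball 0 ε ∩ G ⁻¹' O,
      (hG.continuousOn.mono hbU).isOpen_inter_preimage isOpen_ball hO,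
      ⟨hx.1, ((hmem _).1 hx.2).1⟩, ?_, fun x => h (G x),
      hh.comp_contDiffOn (hG.mono (inter_subset_left.trans hbU)), ?_, ?_⟩
    · refine eq_empty_of_forall_notMem fun z hz => ?_
      have h1 := mem_sphere_zero_iff_norm.1 hz.1.1
      have h2 := mem_ball_zero_iff.1 hz.2.1
      exact h2.ne h1
    · rw [hd x (hbU hx.1)]
      exact (hsurj _ hx.2).comp (hS.ball x (ball_subset_closedBall hx.1) hx.2)
    · ext z
      constructor
      · rintro ⟨hz1, hz2⟩
        exact ⟨hz2, ((hmem _).1 hz1.2).2⟩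
      · rintro ⟨hz1, hz2⟩
        exact ⟨⟨ball_subset_closedBall hz1.1, (hmem _).2 ⟨hz1.2, hz2⟩⟩, hz1⟩
  · intro x hx
    have hxU : x ∈ U := hεU (sphere_subset_closedBall hx.1)
    have hρ : HasFDerivAt (fun x : E => ‖x‖ ^ 2 - ε ^ 2) (2 • innerSL ℝ x) x :=
      (hasStrictFDerivAt_norm_sq x).hasFDerivAt.sub_const _
    refine ⟨U ∩ G ⁻¹' O, hG.continuousOn.isOpen_inter_preimage hU hO,
      ⟨hxU, ((hmem _).1 hx.2).1⟩, fun x => h (G x), fun x => ‖x‖ ^ 2 - ε ^ 2,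
      hh.comp_contDiffOn (hG.mono inter_subset_left),
      ((contDiff_norm_sq ℝ).sub contDiff_const).contDiffOn, ?_, ?_, ?_⟩
    · rintro ⟨w, s⟩
      obtain ⟨w', hw'⟩ := hsurj _ hx.2 w
      obtain ⟨v, hv⟩ := hS.sphere x hx.1 hx.2 (w', s / 2)
      have h1 : fderiv ℝ G x v = w' := congrArg Prod.fst hv
      have h2 : inner ℝ x v = s / 2 := congrArg Prod.snd hv
      refine ⟨v, ?_⟩
      simp only [hd x hxU, hρ.fderiv]
      ext1
      · simp [h1, hw']
      · simp [h2, mul_div_cancel₀]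
    · ext z
      constructor
      · rintro ⟨hz1, hz2⟩
        refine ⟨hz2, ((hmem _).1 hz1.2).2, sub_nonpos.2 ?_⟩
        have := mem_closedBall_zero_iff.1 hz1.1
        gcongr
      · rintro ⟨hz1, hz2, hz3⟩
        exact ⟨⟨mem_closedBall_zero_iff.2 (le_of_sq_le_sq (sub_nonpos.1 hz3) hε.le),
          (hmem _).2 ⟨hz1.2, hz2⟩⟩, hz1⟩
    · ext z
      constructor
      · rintro ⟨hz1, hz2⟩
        refine ⟨hz2, ((hmem _).1 hz1.2).2, ?_⟩
        change ‖z‖ ^ 2 - ε ^ 2 = 0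
        rw [mem_sphere_zero_iff_norm.1 hz1.1, sub_self]
      · rintro ⟨hz1, hz2, hz3⟩
        refine ⟨⟨mem_sphere_zero_iff_norm.2 ?_, (hmem _).2 ⟨hz1.2, hz2⟩⟩, hz1⟩
        rwa [sub_eq_zero, sq_eq_sq₀ (norm_nonneg _) hε.le] at hz3

/-- Submersivity on each stratum comes from lifting curves through the trivializations, so no
description of the tangent spaces of `N` is needed. It serves open `N` with `c = 0` and spheres with
`c = 1`. -/
theorem isProperStratifiedSubmersion_of_fibration {G : E → F} {U : Set E} (hU : IsOpen U)
    (hG : ContDiffOn ℝ ∞ G U) {ε : ℝ} (hε : 0 < ε) (hεU : closedBall 0 ε ⊆ U) {c : ℕ}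
    {h : F → Fin c → ℝ} (hh : ContDiff ℝ ∞ h) {O N : Set F} (hO : IsOpen O)
    (hN : N = {y ∈ O | h y = 0}) (hsurj : ∀ y ∈ N, Function.Surjective (fderiv ℝ h y))
    (hS : SubmersiveOver G ε N)
    (hfib : IsLocallyTrivialFibration G (closedBall 0 ε ∩ G ⁻¹' N) (sphere 0 ε ∩ G ⁻¹' N) N) :
    IsProperStratifiedSubmersion G (closedBall 0 ε ∩ G ⁻¹' N) (sphere 0 ε ∩ G ⁻¹' N) N :=
  ⟨isProperOn_of_isCompact (isCompact_closedBall _ _) (hG.continuousOn.mono hεU) N,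
    ⟨c, isSubmanifoldWithBoundary_preimage hU hG hε hεU hh hO hN hsurj hS⟩,
    ⟨c, isSubmanifoldWithBoundary_zeroSet hh hO hN hsurj⟩, hfib.1, hfib.interior.isSubmersionOn,
    (hfib.boundary (inter_subset_inter_left _ sphere_subset_closedBall)).isSubmersionOn⟩

theorem isProperStratifiedSubmersion_open {G : E → F} {U : Set E} (hU : IsOpen U)
    (hG : ContDiffOn ℝ ∞ G U) {ε : ℝ} (hε : 0 < ε) (hεU : closedBall 0 ε ⊆ U) {N : Set F}
    (hN : IsOpen N) (hS : SubmersiveOver G ε N) :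
    IsProperStratifiedSubmersion G (closedBall 0 ε ∩ G ⁻¹' N) (sphere 0 ε ∩ G ⁻¹' N) N :=
  isProperStratifiedSubmersion_of_fibration hU hG hε hεU (c := 0) (h := fun _ => 0)
    contDiff_const hN (by ext; simp) (fun _ _ w => ⟨0, Subsingleton.elim _ _⟩) hS
    (isLocallyTrivialFibration_of_submersiveOver hU hG hεU hN hS)

theorem isProperStratifiedSubmersion_sphere {G : E → F} {U : Set E} (hU : IsOpen U)
    (hG : ContDiffOn ℝ ∞ G U) {ε : ℝ} (hε : 0 < ε) (hεU : closedBall 0 ε ⊆ U) {δ : ℝ}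
    (hδ : 0 < δ) (hS : SubmersiveOver G ε (sphere 0 δ))
    (hfib : IsLocallyTrivialFibration G (closedBall 0 ε ∩ G ⁻¹' sphere 0 δ)
      (sphere 0 ε ∩ G ⁻¹' sphere 0 δ) (sphere 0 δ)) :
    IsProperStratifiedSubmersion G (closedBall 0 ε ∩ G ⁻¹' sphere 0 δ)
      (sphere 0 ε ∩ G ⁻¹' sphere 0 δ) (sphere 0 δ) := by
  refine isProperStratifiedSubmersion_of_fibration hU hG hε hεU (c := 1)
    (h := fun y _ => ‖y‖ ^ 2 - δ ^ 2)
    (contDiff_pi.2 fun _ => (contDiff_norm_sq ℝ).sub contDiff_const) isOpen_univ ?_ ?_ hS hfib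
  · ext y
    simp only [mem_sphere_zero_iff_norm, mem_ofPred_eq, mem_univ, true_and, funext_iff,
      Pi.zero_apply, forall_const]
    rw [sub_eq_zero, sq_eq_sq₀ (norm_nonneg _) hδ.le]
  · intro y hy w
    have hd : HasFDerivAt (fun (y : F) (_ : Fin 1) => ‖y‖ ^ 2 - δ ^ 2)
        (ContinuousLinearMap.pi fun _ => 2 • innerSL ℝ y) y :=
      hasFDerivAt_pi.2 fun _ => (hasStrictFDerivAt_norm_sq y).hasFDerivAt.sub_const _
    have hyδ := mem_sphere_zero_iff_norm.1 hy
    -- The derivative of `‖y‖²` in the direction `y` is `2 δ²`.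
    refine ⟨(w 0 / (2 * δ ^ 2)) • y, ?_⟩
    rw [hd.fderiv]
    ext i
    rw [Subsingleton.elim i 0]
    simp only [ContinuousLinearMap.coe_pi', smul_apply, innerSL_apply_apply,
      inner_smul_right, real_inner_self_eq_norm_sq, hyδ]
    rw [nsmul_eq_mul]
    push_cast
    field_simp

theorem mem_tangentVectors_of_isOpen {N : Set F} (hN : IsOpen N) {y : F} (hy : y ∈ N) (w : F) :
    w ∈ tangentVectors N y := by
  have hs : ContDiff ℝ ∞ fun t : ℝ => y + t • w := by fun_prop
  have hopen := hN.preimage hs.continuous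
  obtain ⟨r, hr, hrsub⟩ := Metric.isOpen_iff.1 hopen 0 (by simpa using hy)
  rw [Real.ball_eq_Ioo, zero_sub, zero_add] at hrsub
  refine ⟨fun t => y + t • w, ⟨by simp, r, hr, hs.contDiffOn, fun t ht => hrsub ht⟩, ?_⟩
  simpa using ((hasDerivAt_id (0 : ℝ)).smul_const w).const_add y

theorem IsSubmersionOn.exists_velocity {G : E → F} {M : Set E} {N : Set F}
    (h : IsSubmersionOn G M N) (hN : IsOpen N) {x : E} (hx : x ∈ M)
    (hG : DifferentiableAt ℝ G x) (w : F) :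
    ∃ v ∈ tangentVectors M x, fderiv ℝ G x v = w := by
  obtain ⟨γ, hγ, hγd⟩ := h.2.2 x hx w (mem_tangentVectors_of_isOpen hN (h.2.1 hx) w)
  obtain ⟨hγ0, η, hη, hγs, -⟩ := id hγ
  have hd : HasDerivAt γ (deriv γ 0) 0 :=
    ((hγs.contDiffAt (isOpen_Ioo.mem_nhds ⟨by linarith, hη⟩)).differentiableAt
      (by simp)).hasDerivAt
  refine ⟨deriv γ 0, ⟨γ, hγ, hd⟩, ?_⟩
  have hG' : HasFDerivAt G (fderiv ℝ G x) (γ 0) := by rw [hγ0]; exact hG.hasFDerivAt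
  exact (hG'.comp_hasDerivAt (0 : ℝ) hd).unique hγd

theorem inner_eq_zero_of_mem_tangentVectors {M : Set E} {ε : ℝ} (hM : M ⊆ sphere 0 ε) {x v : E}
    (hv : v ∈ tangentVectors M x) : inner ℝ x v = 0 := by
  obtain ⟨γ, ⟨hγ0, η, hη, -, hγM⟩, hγd⟩ := hv
  have h1 := hγd.norm_sq
  have h2 : HasDerivAt (fun t => ‖γ t‖ ^ 2) 0 0 := by
    refine (hasDerivAt_const (0 : ℝ) (ε ^ 2)).congr_of_eventuallyEq ?_
    filter_upwards [isOpen_Ioo.mem_nhds (show (0 : ℝ) ∈ Ioo (-η) η from ⟨by linarith, hη⟩)]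
      with t ht
    rw [mem_sphere_zero_iff_norm.1 (hM (hγM t ht))]
  have := h1.unique h2
  rw [hγ0] at this
  linarith

/-- As `N` is open, every vector of `F` is a velocity in `N`, so lifting velocities means
surjectivity of `dG` on the tangent vectors of each stratum. -/
theorem IsStratifiedSubmersion.submersiveOver {G : E → F} {U : Set E} (hU : IsOpen U)
    (hG : ContDiffOn ℝ ∞ G U) {ε : ℝ} (hε : 0 < ε) (hεU : closedBall 0 ε ⊆ U) {N : Set F}
    (hN : IsOpen N) (h : IsStratifiedSubmersion G (closedBall 0 ε ∩ G ⁻¹' N)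
      (sphere 0 ε ∩ G ⁻¹' N) N) : SubmersiveOver G ε N := by
  obtain ⟨-, -, -, hint, hbd⟩ := h
  rw [closedBall_inter_sdiff_sphere_inter] at hint
  have hdiff : ∀ x ∈ closedBall (0 : E) ε, DifferentiableAt ℝ G x := fun x hx =>
    (hG.contDiffAt (hU.mem_nhds (hεU hx))).differentiableAt (by simp)
  have hsp : ∀ x ∈ sphere (0 : E) ε, G x ∈ N →
      Function.Surjective ((fderiv ℝ G x).prod (innerSL ℝ x)) := by
    rintro x hx hxN ⟨w, s⟩
    have hxε := mem_sphere_zero_iff_norm.1 hx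
    -- The radial vector `(s / ε²) x` has inner product `s` with `x`; a vector tangent to the sphere
    -- then corrects the value of `dG` without changing that product.
    obtain ⟨v, hv, hvw⟩ := hbd.exists_velocity hN ⟨hx, hxN⟩
      (hdiff x (sphere_subset_closedBall hx)) (w - fderiv ℝ G x ((s / ε ^ 2) • x))
    have h0 := inner_eq_zero_of_mem_tangentVectors inter_subset_left hv
    refine ⟨(s / ε ^ 2) • x + v, ?_⟩
    ext
    · simp only [ContinuousLinearMap.prod_apply, map_add, hvw, Prod.fst_add, add_sub_cancel]
    · simp only [ContinuousLinearMap.prod_apply, innerSL_apply_apply, inner_add_right, h0,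
        inner_smul_right, real_inner_self_eq_norm_sq, hxε, add_zero]
      field_simp
  refine ⟨fun x hx hxN => ?_, hsp⟩
  rw [← ball_union_sphere] at hx
  rcases hx with hx | hx
  · intro w
    obtain ⟨v, -, hvw⟩ := hint.exists_velocity hN ⟨hx, hxN⟩
      (hdiff x (ball_subset_closedBall hx)) w
    exact ⟨v, hvw⟩
  · intro w
    obtain ⟨v, hv⟩ := hsp x hx hxN (w, 0)
    exact ⟨v, congrArg Prod.fst hv⟩

end StratifiedSubmersions

/-! ### Consequences of Milnor's conditions -/

section Gradients

variable {n k : ℕ}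

/-- A functional with prescribed values on the independent family extends from its span, and Riesz
represents it. This turns independent gradients into a surjective differential. -/
theorem exists_inner_eq_of_linearIndependent {E ι : Type*} [NormedAddCommGroup E]
    [InnerProductSpace ℝ E] [FiniteDimensional ℝ E] {w : ι → E} (hw : LinearIndependent ℝ w)
    (c : ι → ℝ) : ∃ v : E, ∀ i, inner ℝ (w i) v = c i := by
  obtain ⟨f, hf⟩ := ((Module.Basis.span hw).constr ℝ c).exists_extend
  refine ⟨(InnerProductSpace.toDual ℝ E).symm f.toContinuousLinearMap, fun i => ?_⟩
  rw [real_inner_comm, InnerProductSpace.toDual_symm_apply]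
  have h1 : f.comp (Submodule.subtype _) (Module.Basis.span hw i) = c i := by
    rw [hf, Module.Basis.constr_basis]
  rw [LinearMap.comp_apply, Submodule.subtype_apply, Module.Basis.span_apply] at h1
  exact h1

theorem inner_gradient_apply {G : EuclideanSpace ℝ (Fin n) → EuclideanSpace ℝ (Fin k)}
    {x : EuclideanSpace ℝ (Fin n)} (hG : DifferentiableAt ℝ G x) (i : Fin k)
    (v : EuclideanSpace ℝ (Fin n)) :
    inner ℝ (gradient (fun y => G y i) x) v = fderiv ℝ G x v i := by
  have hd : HasFDerivAt (fun y => G y i)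
      ((EuclideanSpace.proj i : EuclideanSpace ℝ (Fin k) →L[ℝ] ℝ).comp (fderiv ℝ G x)) x :=
    (EuclideanSpace.proj i : EuclideanSpace ℝ (Fin k) →L[ℝ] ℝ).hasFDerivAt.comp x hG.hasFDerivAt
  rw [gradient, InnerProductSpace.toDual_symm_apply, hd.fderiv]
  rfl

theorem surjective_fderiv_of_linearIndependent
    {G : EuclideanSpace ℝ (Fin n) → EuclideanSpace ℝ (Fin k)}
    {x : EuclideanSpace ℝ (Fin n)} (hG : DifferentiableAt ℝ G x)
    (h : LinearIndependent ℝ (fun i : Fin k => gradient (fun y => G y i) x)) :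
    Function.Surjective (fderiv ℝ G x) := by
  intro w
  obtain ⟨v, hv⟩ := exists_inner_eq_of_linearIndependent h (fun i => w i)
  refine ⟨v, ?_⟩
  ext i
  rw [← inner_gradient_apply hG, hv]

theorem surjective_fderiv_prod_of_linearIndependent
    {G : EuclideanSpace ℝ (Fin n) → EuclideanSpace ℝ (Fin k)}
    {x : EuclideanSpace ℝ (Fin n)} (hG : DifferentiableAt ℝ G x)
    (h : LinearIndependent ℝ
      (Fin.cons (gradient (fun y : EuclideanSpace ℝ (Fin n) => ‖y‖ ^ 2) x)
        (fun i : Fin k => gradient (fun y => G y i) x) :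
          Fin (k + 1) → EuclideanSpace ℝ (Fin n))) :
    Function.Surjective ((fderiv ℝ G x).prod (innerSL ℝ x)) := by
  rintro ⟨w, s⟩
  obtain ⟨v, hv⟩ := exists_inner_eq_of_linearIndependent h (Fin.cons (2 * s) fun i => w i)
  have h0 := hv 0
  simp only [Fin.cons_zero] at h0
  rw [gradient, InnerProductSpace.toDual_symm_apply,
    (hasStrictFDerivAt_norm_sq x).hasFDerivAt.fderiv] at h0
  refine ⟨v, ?_⟩
  ext i
  · have hi := hv i.succ
    simp only [Fin.cons_succ] at hi
    rw [inner_gradient_apply hG] at hi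
    exact hi
  · simp only [smul_apply, innerSL_apply_apply, nsmul_eq_mul] at h0
    push_cast at h0
    simp only [ContinuousLinearMap.prod_apply, innerSL_apply_apply]
    linarith

/-- Away from the origin, the spheres inside a Milnor ball are transverse to the fibres of `G` over
all sufficiently small nonzero values. -/
theorem IsMilnorRadius.exists_transverse {U : Set (EuclideanSpace ℝ (Fin n))} (hU : IsOpen U)
    {G : EuclideanSpace ℝ (Fin n) → EuclideanSpace ℝ (Fin k)} (hG : ContDiffOn ℝ ∞ G U)
    {ε₀ : ℝ} (hε₀ : IsMilnorRadius U G ε₀) {ρ : ℝ} (hρ : 0 < ρ) :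
    ∃ δ > 0, ∀ x ∈ closedBall (0 : EuclideanSpace ℝ (Fin n)) ε₀, ρ ≤ ‖x‖ → 0 < ‖G x‖ →
      ‖G x‖ < δ → Function.Surjective ((fderiv ℝ G x).prod (innerSL ℝ x)) := by
  obtain ⟨-, hεU, -, hB⟩ := hε₀
  -- By condition (b) the only zero of `G` that this compact set could contain is the origin, which
  -- `ρ ≤ ‖x‖` excludes; hence `‖G‖` has a positive lower bound on it.
  set K : Set (EuclideanSpace ℝ (Fin n)) :=
    closedBall 0 ε₀ ∩ ({x | ρ ≤ ‖x‖} ∩ closure (relCritLocus U G \ zeroLocus U G)) with hK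
  have hKc : IsCompact K := (isCompact_closedBall _ _).inter_right
    ((isClosed_le continuous_const continuous_norm).inter isClosed_closure)
  obtain ⟨δ, hδ, hδK⟩ := hKc.exists_forall_le' (a := 0) (f := fun x => ‖G x‖)
    ((hG.continuousOn.mono (inter_subset_left.trans hεU)).norm) (by
      intro x hx
      rw [norm_pos_iff]
      intro h0
      have h1 : x ∈ ({0} : Set (EuclideanSpace ℝ (Fin n))) :=
        hB ⟨hx.1, ⟨hεU hx.1, h0⟩, hx.2.2⟩
      have h2 : ρ ≤ ‖x‖ := hx.2.1
      rw [mem_singleton_iff.1 h1, norm_zero] at h2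
      linarith)
  refine ⟨δ, hδ, fun x hx hxρ hx0 hxδ => ?_⟩
  have hxU := hεU hx
  refine surjective_fderiv_prod_of_linearIndependent
    ((hG.contDiffAt (hU.mem_nhds hxU)).differentiableAt (by simp)) ?_
  by_contra hli
  refine absurd (hδK x ⟨hx, hxρ, subset_closure ⟨⟨hxU, hli⟩, fun hz => ?_⟩⟩) (not_le.2 hxδ)
  exact (norm_pos_iff.1 hx0) hz.2

theorem IsMilnorRadius.surjective_fderiv {U : Set (EuclideanSpace ℝ (Fin n))} (hU : IsOpen U)
    {G : EuclideanSpace ℝ (Fin n) → EuclideanSpace ℝ (Fin k)} (hG : ContDiffOn ℝ ∞ G U)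
    {ε₀ : ℝ} (hε₀ : IsMilnorRadius U G ε₀) {x : EuclideanSpace ℝ (Fin n)}
    (hx : x ∈ closedBall 0 ε₀) (hGx : G x ≠ 0) : Function.Surjective (fderiv ℝ G x) := by
  obtain ⟨-, hεU, hA, -⟩ := hε₀
  have hxU := hεU hx
  refine surjective_fderiv_of_linearIndependent
    ((hG.contDiffAt (hU.mem_nhds hxU)).differentiableAt (by simp)) ?_
  by_contra hli
  exact (notMem_empty x) (hA ▸ ⟨hx, subset_closure ⟨⟨hxU, hli⟩, fun hz => hGx hz.2⟩⟩)

theorem IsMilnorRadius.exists_submersiveOver {U : Set (EuclideanSpace ℝ (Fin n))} (hU : IsOpen U)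
    {G : EuclideanSpace ℝ (Fin n) → EuclideanSpace ℝ (Fin k)} (hG : ContDiffOn ℝ ∞ G U)
    {ε₀ : ℝ} (hε₀ : IsMilnorRadius U G ε₀) {ε : ℝ} (hε : 0 < ε) (hεε₀ : ε < ε₀) :
    ∃ δ > 0, SubmersiveOver G ε (ball 0 δ \ {0}) := by
  obtain ⟨δ, hδ, h⟩ := hε₀.exists_transverse hU hG hε
  have hsub : closedBall (0 : EuclideanSpace ℝ (Fin n)) ε ⊆ closedBall 0 ε₀ :=
    closedBall_subset_closedBall hεε₀.le
  exact ⟨δ, hδ, fun x hx hxC => hε₀.surjective_fderiv hU hG (hsub hx) hxC.2,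
    fun x hx hxC => h x (hsub (sphere_subset_closedBall hx)) (mem_sphere_zero_iff_norm.1 hx).ge
      (norm_pos_iff.2 hxC.2) (mem_ball_zero_iff.1 hxC.1)⟩

/-- Transversality is taken down to radius `ε / 2` and, since `exists_change_radius` needs it up to
the level `2 * δ`, the bound on `δ` is halved. -/
theorem IsMilnorRadius.exists_fibrationDiffeo_of_lt {U : Set (EuclideanSpace ℝ (Fin n))}
    (hU : IsOpen U) {G : EuclideanSpace ℝ (Fin n) → EuclideanSpace ℝ (Fin k)}
    (hG : ContDiffOn ℝ ∞ G U) {ε₀ : ℝ} (hε₀ : IsMilnorRadius U G ε₀) {ε ε' : ℝ} (hε : 0 < ε)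
    (hεε' : ε < ε') (hε' : ε' < ε₀) :
    ∃ δ₁ > 0, ∀ δ, 0 < δ → δ < δ₁ → ∃ Φ, IsFibrationDiffeo G
      (closedBall 0 ε ∩ G ⁻¹' sphere 0 δ) (sphere 0 ε ∩ G ⁻¹' sphere 0 δ) (sphere 0 δ)
      (closedBall 0 ε' ∩ G ⁻¹' sphere 0 δ) (sphere 0 ε' ∩ G ⁻¹' sphere 0 δ) (sphere 0 δ)
      Φ id := by
  obtain ⟨δ₁, hδ₁, h⟩ := hε₀.exists_transverse hU hG (half_pos hε)
  refine ⟨δ₁ / 2, half_pos hδ₁, fun δ hδ hδδ₁ => ?_⟩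
  exact exists_change_radius hU hG hε₀.2.1 hε hεε' hε' hδ fun x hx hxρ hx0 hxδ =>
    h x hx hxρ hx0 (by linarith)

theorem IsMilnorRadius.exists_fibrationDiffeo {U : Set (EuclideanSpace ℝ (Fin n))}
    (hU : IsOpen U) {G : EuclideanSpace ℝ (Fin n) → EuclideanSpace ℝ (Fin k)}
    (hG : ContDiffOn ℝ ∞ G U) {ε₀ : ℝ} (hε₀ : IsMilnorRadius U G ε₀) {ε ε' : ℝ} (hε : 0 < ε)
    (hεε₀ : ε < ε₀) (hε' : 0 < ε') (hε'ε₀ : ε' < ε₀) :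
    ∃ δ₁ > 0, ∀ δ, 0 < δ → δ < δ₁ → ∃ Φ, IsFibrationDiffeo G
      (closedBall 0 ε ∩ G ⁻¹' sphere 0 δ) (sphere 0 ε ∩ G ⁻¹' sphere 0 δ) (sphere 0 δ)
      (closedBall 0 ε' ∩ G ⁻¹' sphere 0 δ) (sphere 0 ε' ∩ G ⁻¹' sphere 0 δ) (sphere 0 δ)
      Φ id := by
  have hid : ∀ {X : Type} [NormedAddCommGroup X] [NormedSpace ℝ X] (S : Set X),
      IsDiffeoOn (id : X → X) S S := fun S =>
    ⟨SmoothOnSet.of_contDiffOn isOpen_univ contDiffOn_id (subset_univ _), mapsTo_id S, id,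
      SmoothOnSet.of_contDiffOn isOpen_univ contDiffOn_id (subset_univ _), mapsTo_id S,
      fun _ _ => rfl, fun _ _ => rfl⟩
  rcases lt_trichotomy ε ε' with h | rfl | h
  · exact hε₀.exists_fibrationDiffeo_of_lt hU hG hε h hε'ε₀
  · exact ⟨1, one_pos, fun δ _ _ => ⟨id, hid _, image_id _, hid _, fun _ _ => rfl⟩⟩
  · obtain ⟨δ₁, hδ₁, H⟩ := hε₀.exists_fibrationDiffeo_of_lt hU hG hε' h hεε₀
    refine ⟨δ₁, hδ₁, fun δ hδ hδδ₁ => ?_⟩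
    obtain ⟨Φ, hΦ⟩ := H δ hδ hδδ₁
    exact hΦ.exists_symm (inter_subset_inter_left _ sphere_subset_closedBall)
      (fun x hx => hx.2) (hid _) fun _ _ => rfl

end Gradients

theorem sphere_subset_ball_sdiff_zero {X : Type*} [NormedAddCommGroup X] {δ δ₀ : ℝ} (hδ : 0 < δ)
    (hδ₀ : δ < δ₀) : sphere (0 : X) δ ⊆ ball 0 δ₀ \ {0} := by
  intro y hy
  have h := mem_sphere_zero_iff_norm.1 hy
  refine ⟨mem_ball_zero_iff.2 (h.trans_lt hδ₀), ?_⟩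
  rintro rfl
  rw [norm_zero] at h
  exact hδ.ne h

end MilnorFib

/-! ### The fibration theorem -/

theorem mainTheorem4 {n k : ℕ} (U : Set (EuclideanSpace ℝ (Fin n))) (hU : IsOpen U)
    (h0U : (0 : EuclideanSpace ℝ (Fin n)) ∈ U)
    (G : EuclideanSpace ℝ (Fin n) → EuclideanSpace ℝ (Fin k))
    (hG : ContDiffOn ℝ ∞ G U) (hG0 : G 0 = 0)
    (hGnc : ¬ ∀ᶠ x in 𝓝 (0 : EuclideanSpace ℝ (Fin n)), G x = G 0)
    (ha : MilnorFib.MilnorCondA U G) (hb : MilnorFib.MilnorCondB U G)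
    (ε₀ : ℝ) (hε₀ : MilnorFib.IsMilnorRadius U G ε₀) :
    -- existence of `δ_ε`
    (∀ ε, 0 < ε → ε < ε₀ → ∃ δε > 0, MilnorFib.IsTubePair G ε δε) ∧
    -- every such pair gives locally trivial fibrations
    (∀ ε δε, 0 < ε → ε < ε₀ → 0 < δε → MilnorFib.IsTubePair G ε δε →
      MilnorFib.IsLocallyTrivialFibration G
        (closedBall 0 ε ∩ G ⁻¹' (ball 0 δε \ {0})) (sphere 0 ε ∩ G ⁻¹' (ball 0 δε \ {0}))
        (ball 0 δε \ {0}) ∧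
      ∀ δ, 0 < δ → δ < δε →
        MilnorFib.IsProperStratifiedSubmersion G
          (closedBall 0 ε ∩ G ⁻¹' sphere 0 δ) (sphere 0 ε ∩ G ⁻¹' sphere 0 δ) (sphere 0 δ) ∧
        MilnorFib.IsLocallyTrivialFibration G
          (closedBall 0 ε ∩ G ⁻¹' sphere 0 δ) (sphere 0 ε ∩ G ⁻¹' sphere 0 δ) (sphere 0 δ) ∧
        MilnorFib.IsLocallyTrivialFibration G
          (ball 0 ε ∩ G ⁻¹' sphere 0 δ) ∅ (sphere 0 δ)) ∧
    -- the diffeomorphism types do not depend on the choices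
    (∀ ε δε ε' δε', 0 < ε → ε < ε₀ → 0 < δε → MilnorFib.IsTubePair G ε δε →
      0 < ε' → ε' < ε₀ → 0 < δε' → MilnorFib.IsTubePair G ε' δε' →
      ∀ δ δ', 0 < δ → δ < δε → 0 < δ' → δ' < δε' →
        (∃ Φ, MilnorFib.IsFibrationDiffeo G
          (closedBall 0 ε ∩ G ⁻¹' sphere 0 δ) (sphere 0 ε ∩ G ⁻¹' sphere 0 δ) (sphere 0 δ)
          (closedBall 0 ε' ∩ G ⁻¹' sphere 0 δ') (sphere 0 ε' ∩ G ⁻¹' sphere 0 δ') (sphere 0 δ')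
          Φ (fun y => (δ' / δ) • y)) ∧
        (∃ Φ, MilnorFib.IsFibrationDiffeo G
          (ball 0 ε ∩ G ⁻¹' sphere 0 δ) ∅ (sphere 0 δ)
          (ball 0 ε' ∩ G ⁻¹' sphere 0 δ') ∅ (sphere 0 δ')
          Φ (fun y => (δ' / δ) • y))) := by
  have hN : ∀ δ : ℝ, IsOpen (ball (0 : EuclideanSpace ℝ (Fin k)) δ \ {0}) := fun δ =>
    isOpen_ball.sdiff isClosed_singleton
  have hsub : ∀ ε, ε < ε₀ → closedBall (0 : EuclideanSpace ℝ (Fin n)) ε ⊆ U := fun ε hε =>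
    (closedBall_subset_closedBall hε.le).trans hε₀.2.1
  have hsubm : ∀ ε δε, 0 < ε → ε < ε₀ → MilnorFib.IsTubePair G ε δε →
      MilnorFib.SubmersiveOver G ε (ball 0 δε \ {0}) := fun ε δε hε hεε₀ h =>
    h.2.submersiveOver hU hG hε (hsub ε hεε₀) (hN δε)
  have hsph : ∀ (ε : ℝ) (A : Set (EuclideanSpace ℝ (Fin n))),
      sphere 0 ε ∩ A ⊆ closedBall 0 ε ∩ A := fun ε A =>
    inter_subset_inter_left _ sphere_subset_closedBall
  refine ⟨?_, ?_, ?_⟩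
  · intro ε hε hεε₀
    obtain ⟨δ, hδ, hS⟩ := hε₀.exists_submersiveOver hU hG hε hεε₀
    exact ⟨δ, hδ, MilnorFib.isProperStratifiedSubmersion_open hU hG hε (hsub ε hεε₀) (hN δ) hS⟩
  · intro ε δε hε hεε₀ _ htube
    have hS := hsubm ε δε hε hεε₀ htube
    have hfib := MilnorFib.isLocallyTrivialFibration_of_submersiveOver hU hG (hsub ε hεε₀) (hN δε) hS
    refine ⟨hfib, fun δ hδ hδε => ?_⟩
    have hsp := MilnorFib.sphere_subset_ball_sdiff_zero (X := EuclideanSpace ℝ (Fin k)) hδ hδε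
    have hfib' := hfib.restrict_base (hsph ε _) hsp
    rw [inter_assoc, inter_assoc, ← preimage_inter, inter_eq_right.2 hsp] at hfib'
    have hint := hfib'.interior
    rw [MilnorFib.closedBall_inter_sdiff_sphere_inter] at hint
    exact ⟨MilnorFib.isProperStratifiedSubmersion_sphere hU hG hε (hsub ε hεε₀) hδ (hS.mono hsp) hfib',
      hfib', hint⟩
  · intro ε δε ε' δε' hε hεε₀ hδε htube hε' hε'ε₀ hδε' htube' δ δ' hδ hδδε hδ' hδ'δε'
    obtain ⟨δ₁, hδ₁, H⟩ := hε₀.exists_fibrationDiffeo hU hG hε hεε₀ hε' hε'ε₀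
    -- A level `d` below all three bounds: the level goes from `δ` to `d` inside `B_ε`, the radius
    -- from `ε` to `ε'` at level `d`, then the level from `d` to `δ'` inside `B_ε'`. The rescalings
    -- of the base multiply to `δ' / δ`.
    obtain ⟨d, hd, hdlt⟩ := exists_between (lt_min hδ₁ (lt_min hδε hδε'))
    rw [lt_min_iff, lt_min_iff] at hdlt
    obtain ⟨Φ₁, h₁⟩ := MilnorFib.exists_rescale hU hG (hsub ε hεε₀) (hsubm ε δε hε hεε₀ htube)
      hδ hδδε hd hdlt.2.1
    obtain ⟨Φ₂, h₂⟩ := H d hd hdlt.1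
    obtain ⟨Φ₃, h₃⟩ := MilnorFib.exists_rescale hU hG (hsub ε' hε'ε₀) (hsubm ε' δε' hε' hε'ε₀ htube')
      hd hdlt.2.2 hδ' hδ'δε'
    have h := (h₁.trans h₂).trans h₃
    have e : (fun y : EuclideanSpace ℝ (Fin k) => (δ' / d) • y) ∘
        (id ∘ fun y : EuclideanSpace ℝ (Fin k) => (d / δ) • y) = fun y => (δ' / δ) • y := by
      funext y
      simp only [Function.comp_apply, id_eq, smul_smul]
      congr 1
      field_simp
    rw [e] at h
    have hint := h.interior (hsph ε _)
    rw [MilnorFib.closedBall_inter_sdiff_sphere_inter, MilnorFib.closedBall_inter_sdiff_sphere_inter] at hint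
    exact ⟨⟨_, h⟩, ⟨_, hint⟩⟩
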